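/- In no-wait flowshop, an instance consists of $n$ jobs, $m\ge 1$ machines and processing times $t_{ji}\in\mathbb{Z}_{\ge 0}$ for $1\le j\le n$, $1\le i\le m$. Job $j$ consists of $m$ operations, the $i$-th of which has to be processed without interruption for $t_{ji}$ time units on machine $i$. A feasible (no-wait permutation) schedule assigns to each operation a starting time $S_{ji}\in[0,\infty)$ such that $S_{j,i+1}=S_{ji}+t_{ji}$ for all $j$ and all $i<m$, and such that, for some permutation $\sigma$ of the jobs, $S_{\sigma(k),i}+t_{\sigma(k),i}\le S_{\sigma(l),i}$ for all $k<l$ and all machines $i$ (operations of length zero included). Its makespan is $\max_{j,i}(S_{ji}+t_{ji})$. Let $C_{\max}(\sigma)$ be the minimum makespan of a feasible schedule with job order $\sigma$, and $C^*_{\max}=\min_\sigma C_{\max}(\sigma)$. Theorem. There is an $O(\log m)$-approximation algorithm for no-wait flowshop. That is, there are a constant $C$ and an algorithm that, given any instance (all numbers written in binary, $n$ and $m$ being part of the input), computes in time polynomial in the length of the input a permutation $\sigma$ of the jobs with $$C_{\max}(\sigma)\le \max\{1,\;C\log_2 m\}\cdot C^*_{\max}.$$ (Running time is measured on a random access machine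 with logarithmic cost, that is, every instruction is charged the number of bits of the numbers it handles.) -/

import Mathlib

open scoped NNReal

/-! ## The model of computation: while-programs on a random access machine, logarithmic cost -/

namespace RAM

/-- The memory: array number `a` holds the natural number `s a i` in its cell `i`. A program names
only finitely many arrays, but may address the cells of an array indirectly. -/
abbrev Memory : Type := ℕ → ℕ → ℕ

/-- Arithmetic expressions; `read a i` is the content of cell `i` of array `a`,
and `sub` is truncated subtraction. -/
inductive Expr : Type
  | const (c : ℕ) : Expr
  | read (a : ℕ) (i : Expr) : Expr
  | add (e f : Expr) : Expr
  | sub (e f : Expr) : Expr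
  | mul (e f : Expr) : Expr

namespace Expr

/-- The value of an expression. -/
def eval (s : Memory) : Expr → ℕ
  | const c => c
  | read a i => s a (i.eval s)
  | add e f => e.eval s + f.eval s
  | sub e f => e.eval s - f.eval s
  | mul e f => e.eval s * f.eval s

/-- The time needed to evaluate an expression: every constant, every memory access and every
arithmetic operation is charged one unit plus the number of bits of the numbers (addresses
included) that it handles. -/
def cost (s : Memory) : Expr → ℕ
  | const c => 1 + Nat.size c
  | read a i => i.cost s + (1 + Nat.size (i.eval s) + Nat.size (s a (i.eval s)))
  | add e f => e.cost s + f.cost s + (1 + Nat.size (e.eval s) + Nat.size (f.eval s))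
  | sub e f => e.cost s + f.cost s + (1 + Nat.size (e.eval s) + Nat.size (f.eval s))
  | mul e f => e.cost s + f.cost s + (1 + Nat.size (e.eval s) + Nat.size (f.eval s))

end Expr

/-- Programs; `write a i e` stores the value of `e` in cell `i` of array `a`, and a test succeeds
if the value of the tested expression is not `0`. -/
inductive Prog : Type
  | skip : Prog
  | write (a : ℕ) (i e : Expr) : Prog
  | seq (p q : Prog) : Prog
  | ite (e : Expr) (p q : Prog) : Prog
  | loop (e : Expr) (p : Prog) : Prog

/-- The memory `s` after storing `v` in cell `i` of array `a`. -/
def Memory.set (s : Memory) (a i v : ℕ) : Memory :=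
  Function.update s a (Function.update (s a) i v)

/-- `Exec p s t s'`: the program `p`, started on the memory `s`, halts with the memory `s'`
after time exactly `t`. -/
inductive Exec : Prog → Memory → ℕ → Memory → Prop
  | skip (s : Memory) : Exec Prog.skip s 1 s
  | write (s : Memory) (a : ℕ) (i e : Expr) :
      Exec (Prog.write a i e) s
        (i.cost s + e.cost s + (1 + Nat.size (i.eval s) + Nat.size (e.eval s)))
        (s.set a (i.eval s) (e.eval s))
  | seq {p q : Prog} {s s₁ s₂ : Memory} {t₁ t₂ : ℕ} :
      Exec p s t₁ s₁ → Exec q s₁ t₂ s₂ → Exec (Prog.seq p q) s (t₁ + t₂) s₂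
  | ite_true {e : Expr} {p q : Prog} {s s₁ : Memory} {t : ℕ} :
      e.eval s ≠ 0 → Exec p s t s₁ →
      Exec (Prog.ite e p q) s (e.cost s + (1 + Nat.size (e.eval s)) + t) s₁
  | ite_false {e : Expr} {p q : Prog} {s s₁ : Memory} {t : ℕ} :
      e.eval s = 0 → Exec q s t s₁ →
      Exec (Prog.ite e p q) s (e.cost s + (1 + Nat.size (e.eval s)) + t) s₁
  | loop_true {e : Expr} {p : Prog} {s s₁ s₂ : Memory} {t₁ t₂ : ℕ} :
      e.eval s ≠ 0 → Exec p s t₁ s₁ → Exec (Prog.loop e p) s₁ t₂ s₂ →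
      Exec (Prog.loop e p) s (e.cost s + (1 + Nat.size (e.eval s)) + t₁ + t₂) s₂
  | loop_false {e : Expr} {p : Prog} {s : Memory} :
      e.eval s = 0 → Exec (Prog.loop e p) s (e.cost s + (1 + Nat.size (e.eval s))) s

/-- The initial memory: the input is in array `0`, all other cells are `0`. -/
def initMem (w : List ℕ) : Memory :=
  fun a i => if a = 0 then w.getD i 0 else 0

/-- The length of an input in bits, with one separator for each number. -/
def bitLength (w : List ℕ) : ℕ :=
  (w.map fun x => Nat.size x + 1).sum

end RAM

/-! ## No-wait flowshop -/

/-- An instance of no-wait flowshop: `n` jobs, `m` machines, and the processing time `t j i` of the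
operation of job `j` on machine `i`. Zero processing times are allowed. -/
structure NoWaitFlowshop : Type where
  n : ℕ
  m : ℕ
  m_pos : 0 < m
  t : Fin n → Fin m → ℕ

namespace NoWaitFlowshop

variable (I : NoWaitFlowshop)

/-- A schedule is given by the starting times of all operations. -/
abbrev Schedule : Type := Fin I.n → Fin I.m → ℝ≥0

/-- `S` is a feasible no-wait permutation schedule in which the jobs are processed in the order
`σ 0, σ 1, …, σ (n - 1)`. -/
structure IsFeasible (σ : Equiv.Perm (Fin I.n)) (S : I.Schedule) : Prop where
  /-- Each operation of a job starts at the moment at which the preceding operation ends. -/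
  no_wait : ∀ (j : Fin I.n) (i i' : Fin I.m), (i' : ℕ) = (i : ℕ) + 1 →
    S j i' = S j i + (I.t j i : ℝ≥0)
  /-- On every machine the jobs are executed one after another in the order `σ`; this includes
  the operations of length zero. -/
  order : ∀ (i : Fin I.m) (k l : Fin I.n), k < l →
    S (σ k) i + (I.t (σ k) i : ℝ≥0) ≤ S (σ l) i

/-- The makespan of a schedule: the maximum completion time (`0` if there are no jobs). -/
noncomputable def makespan (S : I.Schedule) : ℝ≥0 :=
  Finset.univ.sup fun j => Finset.univ.sup fun i => S j i + (I.t j i : ℝ≥0)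

/-- The order `σ` is a `ρ`-approximate solution: some feasible schedule that processes the jobs in
the order `σ` has makespan at most `ρ` times the makespan of every feasible schedule. -/
def IsApproximate (ρ : ℝ) (σ : Equiv.Perm (Fin I.n)) : Prop :=
  ∃ S : I.Schedule, I.IsFeasible σ S ∧
    ∀ (τ : Equiv.Perm (Fin I.n)) (S' : I.Schedule), I.IsFeasible τ S' →
      (I.makespan S : ℝ) ≤ ρ * (I.makespan S' : ℝ)

/-- The instance as an input: `n`, `m`, and then the processing times job by job. -/
def encode : List ℕ :=
  I.n :: I.m :: (List.ofFn fun j => List.ofFn (I.t j)).flatten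

/-- The memory `s` contains the order `σ` as the output: cell `k` of array `1` holds the job in
position `k`. -/
def IsOutput (s : RAM.Memory) (σ : Equiv.Perm (Fin I.n)) : Prop :=
  ∀ k : Fin I.n, s 1 k = (σ k : ℕ)

end NoWaitFlowshop

/-- The program `P` is a polynomial-time approximation algorithm for no-wait flowshop with
performance guarantee `ρ m` on the instances with `m` machines, where the number of machines is
part of the input. -/
def IsNoWaitFlowshopApproximation (P : RAM.Prog) (ρ : ℕ → ℝ) : Prop :=
  ∃ time : Polynomial ℕ, ∀ I : NoWaitFlowshop,
    ∃ (t : ℕ) (s : RAM.Memory) (σ : Equiv.Perm (Fin I.n)),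
      RAM.Exec P (RAM.initMem I.encode) t s ∧
      t ≤ time.eval (RAM.bitLength I.encode) ∧
      I.IsOutput s σ ∧
      I.IsApproximate (ρ I.m) σ

/-! ### Polynomial running time of programs with counting loops -/

namespace RAM

/-! In a no-wait schedule one starting time fixes a whole job, and a later job may start as soon as
a delay depending only on the pair of jobs has passed. An order of the jobs therefore costs the
length of a closed tour through the jobs and a dummy job of length zero, and the delays satisfy the
triangle inequality. `IsFeasible.exists_tour` and `exists_schedule_of_tour` translate in both
directions. Let `T` be the integer part of the makespan of any feasible schedule. Every job has
length at most `T`; moreover the load of every machine is at most the length of the tour, so all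
jobs together have length at most `m * T`.

The tour is built from cycle covers. In each round an almost cheapest cycle cover of the active
nodes, of cost at most `3 * T` (`cover_properties`), is composed with the permutation found so far,
and only the shortest job of each cycle stays active. The successor of a surviving job other than
the dummy is dropped and is at least as long, so the total length of the active jobs is halved
(`RoundInv.step`). This is why the guarantee depends on `m` and not on `n`: once `m ≤ 2 ^ r`, the
active jobs have total length at most `T`. The remaining cycles are joined through the dummy node,
where an arc into the dummy costs the length of the job and an arc out of it costs nothing
(`FinishInv.swap`). The result has length at most `(3 * r + 1) * T`, where `2 ^ r < 2 * m`.

The covers come from an auction whose price increment `E` just exceeds the longest job. Prices stay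
below a multiple of `E` that depends only on `n`, so the number of bids is polynomial whatever the
size of the numbers (`AuctionInv.sum_lt`). Since distances are scaled by `n + 1`, the additive error
is only `E ≤ T + 1`, which the constant `3` absorbs.

Running time and correctness are separated. `Cmd.exists_exec_le` derives polynomial time from a
syntactic check: the numbers of rounds are polynomial in `n` and `m`, and each assignment adds only
polynomially many bits. Correctness consists of loop invariants for the function `Cmd.run`. -/

/-- Every number in the memory has at most `b` bits. -/
def Memory.Bounded (s : Memory) (b : ℕ) : Prop := ∀ a i, Nat.size (s a i) ≤ b

theorem Memory.set_of_ne (s : Memory) {a a' : ℕ} (h : a' ≠ a) (i v : ℕ) : s.set a i v a' = s a' := by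
  simp [Memory.set, h]

theorem Memory.set_apply_same (s : Memory) (a i v : ℕ) :
    s.set a i v a = Function.update (s a) i v := by
  simp [Memory.set]

theorem Memory.Bounded.mono {s : Memory} {b b' : ℕ} (h : s.Bounded b) (hb : b ≤ b') :
    s.Bounded b' := fun a i => (h a i).trans hb

theorem Memory.Bounded.set {s : Memory} {b : ℕ} (h : s.Bounded b) (a i : ℕ) {v : ℕ}
    (hv : Nat.size v ≤ b) : (s.set a i v).Bounded b := by
  intro a' i'
  by_cases ha : a' = a
  · subst ha
    rw [Memory.set_apply_same]
    by_cases hi : i' = i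
    · subst hi; simpa using hv
    · simpa [hi] using h a' i'
  · rw [Memory.set_of_ne _ ha]; exact h a' i'

theorem size_le_self (n : ℕ) : Nat.size n ≤ n := Nat.size_le.2 Nat.lt_two_pow_self

theorem size_add_le_max (x y : ℕ) : Nat.size (x + y) ≤ max (Nat.size x) (Nat.size y) + 1 := by
  rw [Nat.size_le, pow_succ]
  have hx := (Nat.lt_size_self x).trans_le
    (Nat.pow_le_pow_right two_pos (le_max_left (Nat.size x) (Nat.size y)))
  have hy := (Nat.lt_size_self y).trans_le
    (Nat.pow_le_pow_right two_pos (le_max_right (Nat.size x) (Nat.size y)))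
  omega

theorem size_mul_le (x y : ℕ) : Nat.size (x * y) ≤ Nat.size x + Nat.size y := by
  rw [Nat.size_le, pow_add]
  exact Nat.mul_lt_mul'' (Nat.lt_size_self x) (Nat.lt_size_self y)

theorem natPolynomial_eval_mono (p : Polynomial ℕ) {x y : ℕ} (h : x ≤ y) :
    p.eval x ≤ p.eval y := by
  rw [Polynomial.eval_eq_sum_range, Polynomial.eval_eq_sum_range]
  gcongr

/-! ### Size and cost of expressions -/

namespace Expr

/-- Expressions whose value is a polynomial in the two cells `0` and `1` of the input array. -/
def isBound : Expr → Bool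
  | const _ => true
  | read a (const i) => a == 0 && decide (i < 2)
  | add e f => e.isBound && f.isBound
  | mul e f => e.isBound && f.isBound
  | _ => false

/-- Expressions whose value has only polynomially many bits more than the numbers in memory. -/
def isTame : Expr → Bool
  | const _ => true
  | read _ _ => true
  | add e f => e.isTame && f.isTame
  | sub e _ => e.isTame
  | mul e f => e.isBound && f.isTame

theorem eval_congr_of_isBound {s s' : Memory} (h : s 0 = s' 0) :
    ∀ {e : Expr}, e.isBound = true → e.eval s = e.eval s'
  | const _, _ => rfl
  | read a (const i), he => by
      simp only [isBound, Bool.and_eq_true, beq_iff_eq] at he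
      simp [eval, he.1, h]
  | add e f, he => by
      simp only [isBound, Bool.and_eq_true] at he
      simp [eval, eval_congr_of_isBound h he.1, eval_congr_of_isBound h he.2]
  | mul e f, he => by
      simp only [isBound, Bool.and_eq_true] at he
      simp [eval, eval_congr_of_isBound h he.1, eval_congr_of_isBound h he.2]
  | sub _ _, he => by simp [isBound] at he
  | read _ (read _ _), he => by simp [isBound] at he
  | read _ (add _ _), he => by simp [isBound] at he
  | read _ (sub _ _), he => by simp [isBound] at he
  | read _ (mul _ _), he => by simp [isBound] at he

/-- Here the value itself, not only its number of bits, is polynomial, so that such expressions may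
serve as numbers of rounds. -/
theorem exists_polynomial_of_isBound : ∀ {e : Expr}, e.isBound = true →
    ∃ p : Polynomial ℕ, ∀ (s : Memory) (R : ℕ), s 0 0 ≤ R → s 0 1 ≤ R → e.eval s ≤ p.eval R
  | const c, _ => ⟨Polynomial.C c, fun _ _ _ _ => by simp [eval]⟩
  | read a (const i), he => ⟨Polynomial.X, fun s R h0 h1 => by
      simp only [isBound, Bool.and_eq_true, beq_iff_eq, decide_eq_true_eq] at he
      obtain ⟨rfl, hi⟩ := he
      interval_cases i <;> simpa [eval]⟩
  | add e f, he => by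
      simp only [isBound, Bool.and_eq_true] at he
      obtain ⟨p, hp⟩ := exists_polynomial_of_isBound he.1
      obtain ⟨q, hq⟩ := exists_polynomial_of_isBound he.2
      refine ⟨p + q, fun s R h0 h1 => ?_⟩
      rw [Polynomial.eval_add]
      exact Nat.add_le_add (hp s R h0 h1) (hq s R h0 h1)
  | mul e f, he => by
      simp only [isBound, Bool.and_eq_true] at he
      obtain ⟨p, hp⟩ := exists_polynomial_of_isBound he.1
      obtain ⟨q, hq⟩ := exists_polynomial_of_isBound he.2
      refine ⟨p * q, fun s R h0 h1 => ?_⟩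
      rw [Polynomial.eval_mul]
      exact Nat.mul_le_mul (hp s R h0 h1) (hq s R h0 h1)
  | sub _ _, he => by simp [isBound] at he
  | read _ (read _ _), he => by simp [isBound] at he
  | read _ (add _ _), he => by simp [isBound] at he
  | read _ (sub _ _), he => by simp [isBound] at he
  | read _ (mul _ _), he => by simp [isBound] at he

/-- The essential point is that `b` enters with coefficient one: additive growth survives iteration
in a loop, whereas a factor would compound. This is why one factor of a product has to be
polynomially bounded, and why truncated subtraction only needs a tame left operand. -/
theorem exists_polynomial_of_isTame : ∀ {e : Expr}, e.isTame = true →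
    ∃ p : Polynomial ℕ, ∀ (s : Memory) (R b : ℕ), s 0 0 ≤ R → s 0 1 ≤ R → s.Bounded b →
      Nat.size (e.eval s) ≤ b + p.eval R
  | const c, _ => ⟨Polynomial.C (Nat.size c), fun _ _ _ _ _ _ => by simp [eval]⟩
  | read _ _, _ => ⟨0, fun s _ _ _ _ hb => by simpa [eval] using hb _ _⟩
  | add e f, he => by
      simp only [isTame, Bool.and_eq_true] at he
      obtain ⟨p, hp⟩ := exists_polynomial_of_isTame he.1
      obtain ⟨q, hq⟩ := exists_polynomial_of_isTame he.2
      refine ⟨p + q + 1, fun s R b h0 h1 hb => ?_⟩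
      have h := size_add_le_max (e.eval s) (f.eval s)
      have hp' := hp s R b h0 h1 hb
      have hq' := hq s R b h0 h1 hb
      simp only [eval, Polynomial.eval_add, Polynomial.eval_one]
      omega
  | sub e f, he => by
      obtain ⟨p, hp⟩ := exists_polynomial_of_isTame (e := e) he
      exact ⟨p, fun s R b h0 h1 hb =>
        (Nat.size_le_size (Nat.sub_le _ _)).trans (hp s R b h0 h1 hb)⟩
  | mul e f, he => by
      simp only [isTame, Bool.and_eq_true] at he
      obtain ⟨p, hp⟩ := exists_polynomial_of_isBound he.1
      obtain ⟨q, hq⟩ := exists_polynomial_of_isTame he.2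
      refine ⟨p + q, fun s R b h0 h1 hb => ?_⟩
      have h := size_mul_le (e.eval s) (f.eval s)
      have hp' := (size_le_self _).trans (hp s R h0 h1)
      have hq' := hq s R b h0 h1 hb
      simp only [eval, Polynomial.eval_add]
      omega

/-- A fixed expression performs a fixed number of operations, and each at most adds the sizes of its
operands, up to a constant. No tameness is needed, so tests and addresses may be arbitrary
expressions. -/
theorem exists_cost_le : ∀ e : Expr, ∃ C : ℕ, ∀ (s : Memory) (b : ℕ), s.Bounded b →
    Nat.size (e.eval s) ≤ C * (b + 1) ∧ e.cost s ≤ C * (b + 1)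
  | const c => ⟨1 + Nat.size c, fun s b _ => by
      simp only [eval, cost]
      constructor <;> nlinarith [Nat.zero_le (Nat.size c * b)]⟩
  | read a i => by
      obtain ⟨C, hC⟩ := exists_cost_le i
      refine ⟨2 * C + 1, fun s b hb => ?_⟩
      have h1 := hC s b hb
      have h2 := hb a (i.eval s)
      simp only [eval, cost]
      constructor <;> nlinarith
  | add e f => by
      obtain ⟨C, hC⟩ := exists_cost_le e
      obtain ⟨D, hD⟩ := exists_cost_le f
      refine ⟨2 * C + 2 * D + 1, fun s b hb => ?_⟩
      have h1 := hC s b hb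
      have h2 := hD s b hb
      have h := size_add_le_max (e.eval s) (f.eval s)
      have h' : max (Nat.size (e.eval s)) (Nat.size (f.eval s)) ≤ _ := max_le_add_of_nonneg
        (Nat.zero_le _) (Nat.zero_le _)
      simp only [eval, cost]
      constructor <;> nlinarith
  | sub e f => by
      obtain ⟨C, hC⟩ := exists_cost_le e
      obtain ⟨D, hD⟩ := exists_cost_le f
      refine ⟨2 * C + 2 * D + 1, fun s b hb => ?_⟩
      have h1 := hC s b hb
      have h2 := hD s b hb
      have h := Nat.size_le_size (Nat.sub_le (e.eval s) (f.eval s))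
      simp only [eval, cost]
      constructor <;> nlinarith
  | mul e f => by
      obtain ⟨C, hC⟩ := exists_cost_le e
      obtain ⟨D, hD⟩ := exists_cost_le f
      refine ⟨2 * C + 2 * D + 1, fun s b hb => ?_⟩
      have h1 := hC s b hb
      have h2 := hD s b hb
      have h := size_mul_le (e.eval s) (f.eval s)
      simp only [eval, cost]
      constructor <;> nlinarith

end Expr

/-- Programs in which every loop is a counting loop. -/
inductive Cmd : Type
  | write (a : ℕ) (i e : Expr) : Cmd
  | seq (p q : Cmd) : Cmd
  | ite (e : Expr) (p q : Cmd) : Cmd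
  | skip : Cmd
  | forLoop (x : ℕ) (e : Expr) (p : Cmd) : Cmd

/-! ### Counting loops: semantics and time -/

namespace Cmd

/-- The counter of a loop is cell `0` of the array `x`. -/
def compile : Cmd → Prog
  | write a i e => Prog.write a i e
  | seq p q => Prog.seq p.compile q.compile
  | ite e p q => Prog.ite e p.compile q.compile
  | skip => Prog.skip
  | forLoop x e p => Prog.seq (Prog.write x (.const 0) (.const 0))
      (Prog.loop (.sub e (.read x (.const 0)))
        (Prog.seq p.compile (Prog.write x (.const 0) (.add (.read x (.const 0)) (.const 1)))))

/-- The memory before round `k` of a counting loop with counter `x` and body `f`. -/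
def iter (x : ℕ) (f : Memory → Memory) (s : Memory) : ℕ → Memory
  | 0 => s.set x 0 0
  | k + 1 => (f (iter x f s k)).set x 0 (k + 1)

/-- The memory after the execution of a program. -/
def run : Cmd → Memory → Memory
  | write a i e, s => s.set a (i.eval s) (e.eval s)
  | seq p q, s => q.run (p.run s)
  | ite e p q, s => if e.eval s ≠ 0 then p.run s else q.run s
  | skip, s => s
  | forLoop x e p, s => iter x p.run s (e.eval s)

/-- The arrays that occur as the target of an assignment. -/
def writes : Cmd → List ℕ
  | write a _ _ => [a]
  | seq p q => p.writes ++ q.writes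
  | ite _ p q => p.writes ++ q.writes
  | skip => []
  | forLoop x _ p => x :: p.writes

/-- Loop counters are not changed by the body, the numbers of rounds are polynomial in the first
two cells of the input, and all assignments are tame. -/
def wf : Cmd → Bool
  | write _ _ e => e.isTame
  | seq p q => p.wf && q.wf
  | ite _ p q => p.wf && q.wf
  | skip => true
  | forLoop x e p => e.isBound && !(p.writes.contains x) && p.wf

theorem run_of_notMem_writes : ∀ (c : Cmd) {a : ℕ}, a ∉ c.writes → ∀ s, c.run s a = s a
  | write a' i e, a, h, s => by
      simp only [writes, List.mem_singleton] at h
      exact Memory.set_of_ne _ h _ _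
  | seq p q, a, h, s => by
      simp only [writes, List.mem_append, not_or] at h
      rw [run, run_of_notMem_writes q h.2, run_of_notMem_writes p h.1]
  | ite e p q, a, h, s => by
      simp only [writes, List.mem_append, not_or] at h
      rw [run]
      split_ifs
      · exact run_of_notMem_writes p h.1 s
      · exact run_of_notMem_writes q h.2 s
  | skip, _, _, _ => rfl
  | forLoop x e p, a, h, s => by
      simp only [writes, List.mem_cons, not_or] at h
      rw [run]
      generalize e.eval s = n
      induction n with
      | zero => exact Memory.set_of_ne _ h.1 _ _
      | succ k ih => rw [iter, Memory.set_of_ne _ h.1, run_of_notMem_writes p h.2, ih]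

theorem iter_counter (x : ℕ) (f : Memory → Memory) (s : Memory) (k : ℕ) :
    iter x f s k x 0 = k := by
  cases k <;> simp [iter, Memory.set_apply_same]

/-- Induction over the rounds of a counting loop. -/
theorem run_forLoop_induction {x : ℕ} {e : Expr} {p : Cmd} {s : Memory} (I : ℕ → Memory → Prop)
    (n : ℕ) (hn : e.eval s = n)
    (hset : ∀ k s' v, I k s' → I k (s'.set x 0 v)) (h0 : I 0 s)
    (hstep : ∀ k < n, ∀ s', s' x 0 = k →
      (∀ a, a ∉ (forLoop x e p).writes → s' a = s a) → I k s' → I (k + 1) (p.run s')) :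
    I n ((forLoop x e p).run s) := by
  rw [run, hn]
  -- The frame condition is carried along with the invariant, so that every round may use that the
  -- other arrays are still those of `s`.
  have key : ∀ k ≤ n, I k (iter x p.run s k) ∧
      ∀ a, a ∉ (forLoop x e p).writes → iter x p.run s k a = s a := by
    intro k
    induction k with
    | zero =>
      intro _
      refine ⟨hset _ _ _ h0, fun a ha => ?_⟩
      simp only [writes, List.mem_cons, not_or] at ha
      exact Memory.set_of_ne _ ha.1 _ _
    | succ k ih =>
      intro hk
      obtain ⟨h1, h2⟩ := ih (by omega)
      refine ⟨hset _ _ _ (hstep k hk _ (iter_counter _ _ _ _) h2 h1), fun a ha => ?_⟩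
      have ha' := ha
      simp only [writes, List.mem_cons, not_or] at ha
      rw [iter, Memory.set_of_ne _ ha.1, run_of_notMem_writes _ ha.2, h2 a ha']
  exact (key n le_rfl).1

/-- The induction is on the number `d` of remaining rounds, because `Exec` peels off the first round
of a loop. `W` pays for one test, one execution of the body and one increment, and once more for the
final test. -/
theorem exec_forLoop {x : ℕ} {e : Expr} {p : Cmd} {s : Memory} {n W : ℕ}
    (hx : x ∉ p.writes)
    (he : ∀ k ≤ n, e.eval (iter x p.run s k) = n)
    (hbody : ∀ k < n, ∃ t, Exec p.compile (iter x p.run s k) t (p.run (iter x p.run s k)) ∧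
      t + (Expr.sub e (.read x (.const 0))).cost (iter x p.run s k) +
        (1 + Nat.size (n - k)) + ((Expr.const 0).cost (p.run (iter x p.run s k)) +
          (Expr.add (.read x (.const 0)) (.const 1)).cost (p.run (iter x p.run s k)) +
          (1 + Nat.size 0 + Nat.size (k + 1))) ≤ W)
    (hend : (Expr.sub e (.read x (.const 0))).cost (iter x p.run s n) + 1 ≤ W) :
    ∀ d k, k + d = n → ∃ t, Exec (Prog.loop (.sub e (.read x (.const 0)))
      (Prog.seq p.compile (Prog.write x (.const 0) (.add (.read x (.const 0)) (.const 1)))))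
      (iter x p.run s k) t (iter x p.run s n) ∧ t ≤ (d + 1) * W := by
  have htest : ∀ k ≤ n, (Expr.sub e (.read x (.const 0))).eval (iter x p.run s k) = n - k := by
    intro k hk
    simp [Expr.eval, he k hk, iter_counter]
  intro d
  induction d with
  | zero =>
    intro k hk
    obtain rfl : k = n := by omega
    refine ⟨_, Exec.loop_false (by simp [htest k le_rfl]), ?_⟩
    simpa [htest k le_rfl] using hend
  | succ d ih =>
    intro k hk
    obtain ⟨t₁, h₁, ht₁⟩ := hbody k (by omega)
    obtain ⟨t₂, h₂, ht₂⟩ := ih (k + 1) (by omega)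
    have hval : p.run (iter x p.run s k) x 0 = k := by
      rw [run_of_notMem_writes p hx, iter_counter]
    have hw := Exec.write (p.run (iter x p.run s k)) x (.const 0)
      (.add (.read x (.const 0)) (.const 1))
    simp only [Expr.eval, hval] at hw
    refine ⟨_, Exec.loop_true (by rw [htest k (by omega)]; omega) (Exec.seq h₁ hw) h₂, ?_⟩
    rw [htest k (by omega)]
    have : (d + 1 + 1) * W = (d + 1) * W + W := by ring
    omega

/-- Well-formed programs that do not write to the input array run in polynomial time. -/
theorem exists_exec_le : ∀ {c : Cmd}, c.wf = true → 0 ∉ c.writes →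
    ∃ g T : Polynomial ℕ, ∀ (R b : ℕ) (s : Memory), s 0 0 ≤ R → s 0 1 ≤ R → s.Bounded b →
      (∃ t, Exec c.compile s t (c.run s) ∧ t ≤ T.eval (R + b)) ∧
        (c.run s).Bounded (b + g.eval R)
  | write a i e, hc, _ => by
      obtain ⟨C, hC⟩ := i.exists_cost_le
      obtain ⟨D, hD⟩ := e.exists_cost_le
      obtain ⟨g, hg⟩ := Expr.exists_polynomial_of_isTame (e := e) hc
      refine ⟨g, Polynomial.C (2 * C + 2 * D + 1) * (Polynomial.X + 1),
        fun R b s h0 h1 hb => ⟨⟨_, Exec.write s a i e, ?_⟩, ?_⟩⟩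
      · have h1 := hC s b hb
        have h2 := hD s b hb
        simp only [Polynomial.eval_mul, Polynomial.eval_C, Polynomial.eval_add, Polynomial.eval_X,
          Polynomial.eval_one]
        have h3 : (2 * C + 2 * D + 1) * (b + 1) ≤ (2 * C + 2 * D + 1) * (R + b + 1) := by
          gcongr; omega
        nlinarith
      · exact (hb.mono (by omega)).set _ _ (hg s R b h0 h1 hb)
  | seq p q, hc, h => by
      simp only [wf, Bool.and_eq_true] at hc
      simp only [writes, List.mem_append, not_or] at h
      obtain ⟨g₁, T₁, h₁⟩ := exists_exec_le hc.1 h.1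
      obtain ⟨g₂, T₂, h₂⟩ := exists_exec_le hc.2 h.2
      -- The second program starts on numbers of up to `b + g₁(R)` bits, which explains the
      -- composition.
      refine ⟨g₁ + g₂, T₁ + T₂.comp (Polynomial.X + g₁), fun R b s h0 h1 hb => ?_⟩
      obtain ⟨⟨t₁, e₁, ht₁⟩, b₁⟩ := h₁ R b s h0 h1 hb
      have hfr := run_of_notMem_writes p h.1 s
      obtain ⟨⟨t₂, e₂, ht₂⟩, b₂⟩ := h₂ R _ (p.run s) (by rwa [hfr]) (by rwa [hfr]) b₁
      refine ⟨⟨_, Exec.seq e₁ e₂, ?_⟩, b₂.mono (by simp [add_assoc])⟩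
      have h3 := natPolynomial_eval_mono g₁ (Nat.le_add_right R b)
      have h4 : T₂.eval (R + (b + g₁.eval R)) ≤ T₂.eval (R + b + g₁.eval (R + b)) :=
        natPolynomial_eval_mono _ (by omega)
      simp only [Polynomial.eval_add, Polynomial.eval_comp, Polynomial.eval_X]
      omega
  | ite e p q, hc, h => by
      simp only [wf, Bool.and_eq_true] at hc
      simp only [writes, List.mem_append, not_or] at h
      obtain ⟨C, hC⟩ := e.exists_cost_le
      obtain ⟨g₁, T₁, h₁⟩ := exists_exec_le hc.1 h.1
      obtain ⟨g₂, T₂, h₂⟩ := exists_exec_le hc.2 h.2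
      refine ⟨g₁ + g₂, T₁ + T₂ + Polynomial.C (2 * C + 1) * (Polynomial.X + 1),
        fun R b s h0 h1 hb => ?_⟩
      obtain ⟨⟨t₁, e₁, ht₁⟩, b₁⟩ := h₁ R b s h0 h1 hb
      obtain ⟨⟨t₂, e₂, ht₂⟩, b₂⟩ := h₂ R b s h0 h1 hb
      have hcost : e.cost s + (1 + Nat.size (e.eval s)) ≤ (2 * C + 1) * (R + b + 1) := by
        have h1 := hC s b hb
        have h3 : (2 * C + 1) * (b + 1) ≤ (2 * C + 1) * (R + b + 1) := by
          gcongr; omega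
        nlinarith
      by_cases hs : e.eval s = 0
      · rw [run, if_neg (by simpa using hs)]
        refine ⟨⟨_, Exec.ite_false hs e₂, ?_⟩, b₂.mono (by simp)⟩
        simp only [Polynomial.eval_mul, Polynomial.eval_C, Polynomial.eval_add, Polynomial.eval_X,
          Polynomial.eval_one]
        omega
      · rw [run, if_pos hs]
        refine ⟨⟨_, Exec.ite_true hs e₁, ?_⟩, b₁.mono (by simp)⟩
        simp only [Polynomial.eval_mul, Polynomial.eval_C, Polynomial.eval_add, Polynomial.eval_X,
          Polynomial.eval_one]
        omega
  | skip, _, _ => ⟨0, 1, fun R b s _ _ hb => ⟨⟨1, Exec.skip s, by simp⟩, by simpa [run] using hb⟩⟩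
  | forLoop x e p, hc, h => by
      simp only [wf, Bool.and_eq_true, Bool.not_eq_true', List.contains_eq_mem,
        decide_eq_false_iff_not] at hc
      obtain ⟨⟨he, hx⟩, hp⟩ := hc
      have h' := h
      simp only [writes, List.mem_cons, not_or] at h
      obtain ⟨q, hq⟩ := Expr.exists_polynomial_of_isBound he
      obtain ⟨g, T, hT⟩ := exists_exec_le hp h.2
      obtain ⟨C, hC⟩ := (Expr.sub e (.read x (.const 0))).exists_cost_le
      obtain ⟨D, hD⟩ := (Expr.add (.read x (.const 0)) (.const 1)).exists_cost_le
      -- The cost of one round: the body on the largest numbers that can occur, then the test and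
      -- the increment, and `q` twice for the sizes of `n - k` and of the counter.
      set W : Polynomial ℕ := T.comp (Polynomial.X + q + q * g) +
        Polynomial.C (C + D + 4) * (Polynomial.X + q + q * g + 1) + q + q with hW
      -- The constant `3` is the cost of resetting the counter.
      refine ⟨q + q * g, Polynomial.C 3 + (q + 1) * W, fun R b s h0 h1 hb => ?_⟩
      obtain ⟨n, hn⟩ : ∃ n, e.eval s = n := ⟨_, rfl⟩
      have hnq : n ≤ q.eval R := hn ▸ hq s R h0 h1
      have hfr : ∀ k, iter x p.run s k 0 = s 0 := by
        intro k
        induction k with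
        | zero => exact Memory.set_of_ne _ h.1 _ _
        | succ k ih => rw [iter, Memory.set_of_ne _ h.1, run_of_notMem_writes p h.2, ih]
      -- The counter is accounted for once by `q`, while each round of the body adds `g`.
      have hbd : ∀ k ≤ n, (iter x p.run s k).Bounded (b + q.eval R + k * g.eval R) := by
        intro k
        induction k with
        | zero => exact fun _ => (hb.mono (by omega)).set _ _ (by simp)
        | succ k ih =>
          intro hk
          have := (hT R _ (iter x p.run s k) (by rwa [hfr]) (by rwa [hfr]) (ih (by omega))).2
          refine (this.mono ?_).set _ _ ?_
          · rw [Nat.succ_mul]; omega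
          · have := size_le_self (k + 1); omega
      set b' := b + q.eval R + q.eval R * g.eval R with hb'
      have hbd' : ∀ k ≤ n, (iter x p.run s k).Bounded b' := fun k hk => (hbd k hk).mono (by
        have : k * g.eval R ≤ q.eval R * g.eval R := Nat.mul_le_mul_right _ (by omega)
        omega)
      have hb'' : R + b' ≤ (R + b) + q.eval (R + b) + q.eval (R + b) * g.eval (R + b) := by
        have h3 := natPolynomial_eval_mono q (Nat.le_add_right R b)
        have h4 := natPolynomial_eval_mono g (Nat.le_add_right R b)
        have := Nat.mul_le_mul h3 h4
        omega
      have hqm := natPolynomial_eval_mono q (Nat.le_add_right R b)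
      have hWe : T.eval (R + b') + (C + D + 4) * (b' + 1) + n + n ≤ W.eval (R + b) := by
        simp only [hW, Polynomial.eval_add, Polynomial.eval_comp, Polynomial.eval_X,
          Polynomial.eval_mul, Polynomial.eval_C, Polynomial.eval_one]
        have h3 := natPolynomial_eval_mono T hb''
        have h4 : (C + D + 4) * (b' + 1) ≤ (C + D + 4) *
          ((R + b) + q.eval (R + b) + q.eval (R + b) * g.eval (R + b) + 1) := by
          gcongr; omega
        omega
      have hrun : (forLoop x e p).run s = iter x p.run s n := by rw [run, hn]
      have hloop := exec_forLoop (x := x) (e := e) (p := p) (s := s) (n := n) (W := W.eval (R + b))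
        hx (fun k _ => by rw [← hn]; exact Expr.eval_congr_of_isBound (hfr k) he)
        (by
          intro k hk
          have hbk := hbd k hk.le
          obtain ⟨⟨t, ht, htT⟩, hbb⟩ := hT R _ (iter x p.run s k) (by rwa [hfr]) (by rwa [hfr]) hbk
          refine ⟨t, ht, ?_⟩
          have hkg : (k + 1) * g.eval R ≤ q.eval R * g.eval R :=
            Nat.mul_le_mul_right _ (by omega)
          rw [Nat.succ_mul] at hkg
          have h5 := natPolynomial_eval_mono T
            (show R + (b + q.eval R + k * g.eval R) ≤ R + b' by omega)
          have h6 := (hC _ _ (hbd' k hk.le)).2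
          have h7 := (hD _ b' (hbb.mono (by omega))).2
          have h8 := size_le_self (n - k)
          have h9 := size_le_self (k + 1)
          have h10 : (Expr.const 0).cost (p.run (iter x p.run s k)) = 1 := by simp [Expr.cost]
          have h11 : (C + D + 4) * (b' + 1) = C * (b' + 1) + D * (b' + 1) + 4 * (b' + 1) := by ring
          have h12 : Nat.size 0 = 0 := Nat.size_zero
          omega)
        (by
          have h6 := (hC _ _ (hbd' n le_rfl)).2
          have h11 : (C + D + 4) * (b' + 1) = C * (b' + 1) + D * (b' + 1) + 4 * (b' + 1) := by ring
          omega)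
      obtain ⟨t, ht, htle⟩ := hloop n 0 (by omega)
      rw [hrun]
      refine ⟨⟨_, Exec.seq (Exec.write s x (.const 0) (.const 0)) ht, ?_⟩,
        (hbd' n le_rfl).mono (by simp [hb', add_assoc])⟩
      simp only [Expr.cost, Expr.eval, Nat.size_zero, Polynomial.eval_add, Polynomial.eval_mul,
        Polynomial.eval_C, Polynomial.eval_one]
      have : (n + 1) * W.eval (R + b) ≤ (q.eval (R + b) + 1) * W.eval (R + b) := by
        gcongr; omega
      omega

end Cmd

end RAM

/-! ## The auction algorithm for the assignment problem -/

/-- The state of the auction: `asg i = j + 1` if object `j` is assigned to person `i`, and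
`asg i = 0` if nothing is; object `j` has the price `k j * E`. -/
structure AuctionInv (N E B : ℕ) (c : ℕ → ℕ → ℕ) (asg k : ℕ → ℕ) : Prop where
  le : ∀ i < N, asg i ≤ N
  inj : ∀ i < N, ∀ i' < N, asg i ≠ 0 → asg i = asg i' → i = i'
  slack : ∀ i < N, ∀ j < N, asg i = j + 1 → ∀ j' < N, c i j + k j * E ≤ c i j' + k j' * E + E
  owned : ∀ j < N, k j ≠ 0 → ∃ i < N, asg i = j + 1
  price : ∀ j < N, k j * E ≤ B + E

namespace AuctionInv

theorem initial (N E B : ℕ) (c : ℕ → ℕ → ℕ) {asg k : ℕ → ℕ} (ha : ∀ i < N, asg i = 0)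
    (hk : ∀ j < N, k j = 0) : AuctionInv N E B c asg k where
  le i hi := by simp [ha i hi]
  inj i hi _ _ h := absurd (ha i hi) h
  slack i hi j _ h := by simp [ha i hi] at h
  owned j hj h := absurd (hk j hj) h
  price j hj := by simp [hk j hj]

variable {N E B : ℕ} {c : ℕ → ℕ → ℕ} {asg k : ℕ → ℕ}

/-- An object whose price has been raised has an owner. If all prices had been raised, `N` objects
would need distinct owners among the `N - 1` persons other than `i`. -/
theorem exists_free (h : AuctionInv N E B c asg k) {i : ℕ} (hi : i < N) (h0 : asg i = 0) :
    ∃ j < N, k j = 0 := by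
  by_contra! hk
  have : ∀ j < N, ∃ i < N, asg i = j + 1 := fun j hj => h.owned j hj (hk j hj)
  choose! f hf hf' using this
  have hmaps : ∀ j ∈ Finset.range N, f j ∈ (Finset.range N).erase i := by
    intro j hj
    rw [Finset.mem_range] at hj
    rw [Finset.mem_erase, Finset.mem_range]
    refine ⟨fun he => ?_, hf j hj⟩
    have := hf' j hj
    rw [he, h0] at this
    omega
  have hinj : Set.InjOn f (Finset.range N : Set ℕ) := by
    intro j hj j' hj' he
    have hj : j < N := by simpa using hj
    have hj' : j' < N := by simpa using hj'
    have h1 := hf' j hj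
    have h2 := hf' j' hj'
    rw [he] at h1
    omega
  have := Finset.card_le_card_of_injOn f hmaps hinj
  rw [Finset.card_erase_of_mem (Finset.mem_range.2 hi), Finset.card_range] at this
  omega

/-- The bidder satisfies the slack condition because `b` was a cheapest object before its price rose
by one increment; the other owners satisfy it because prices never fall. -/
theorem bid (h : AuctionInv N E B c asg k) (hc : ∀ i < N, ∀ j < N, c i j ≤ B) {i b : ℕ}
    (hi : i < N) (h0 : asg i = 0) (hb : b < N)
    (hmin : ∀ j < N, c i b + k b * E ≤ c i j + k j * E) {asg' k' : ℕ → ℕ}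
    (hai : asg' i = b + 1)
    (ha : ∀ i' < N, i' ≠ i → asg' i' = if asg i' = b + 1 then 0 else asg i')
    (hkb : k' b = k b + 1) (hk : ∀ j < N, j ≠ b → k' j = k j) :
    AuctionInv N E B c asg' k' := by
  have hmono : ∀ j < N, k j * E ≤ k' j * E := by
    intro j hj
    by_cases hjb : j = b
    · subst hjb; rw [hkb]; nlinarith
    · rw [hk j hj hjb]
  constructor
  · intro i' hi'
    by_cases hii : i' = i
    · subst hii; omega
    · rw [ha i' hi' hii]
      split_ifs
      · omega
      · exact h.le i' hi'
  · intro i₁ h₁ i₂ h₂ hne heq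
    by_cases e₁ : i₁ = i <;> by_cases e₂ : i₂ = i
    · omega
    · rw [e₁, hai, ha i₂ h₂ e₂] at heq
      split_ifs at heq; omega
    · rw [e₂, hai, ha i₁ h₁ e₁] at heq
      split_ifs at heq; omega
    · rw [ha i₁ h₁ e₁] at hne heq
      rw [ha i₂ h₂ e₂] at heq
      by_cases c₁ : asg i₁ = b + 1
      · simp [c₁] at hne
      · rw [if_neg c₁] at hne heq
        split_ifs at heq
        · omega
        · exact h.inj i₁ h₁ i₂ h₂ hne heq
  · intro i' hi' j hj hij j' hj'
    by_cases hii : i' = i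
    · subst hii
      obtain rfl : b = j := by omega
      have := hmin j' hj'
      have := hmono j' hj'
      rw [hkb, Nat.succ_mul]
      omega
    · rw [ha i' hi' hii] at hij
      split_ifs at hij with hs
      have hjb : j ≠ b := by omega
      have := h.slack i' hi' j hj hij j' hj'
      have := hmono j' hj'
      rw [hk j hj hjb]
      omega
  · intro j hj hkj
    by_cases hjb : j = b
    · exact ⟨i, hi, by rw [hai, hjb]⟩
    · rw [hk j hj hjb] at hkj
      obtain ⟨i', hi', he⟩ := h.owned j hj hkj
      have hii : i' ≠ i := by rintro rfl; omega
      refine ⟨i', hi', ?_⟩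
      rw [ha i' hi' hii, if_neg (by omega), he]
  · intro j hj
    by_cases hjb : j = b
    -- An unassigned person still sees an object of price zero, so the best object costs at most `B`
    -- in total before the raise.
    · obtain ⟨j₀, hj₀, hz⟩ := h.exists_free hi h0
      have h1 := hmin j₀ hj₀
      have h2 := hc i hi j₀ hj₀
      rw [hz] at h1
      rw [hjb, hkb, Nat.succ_mul]
      omega
    · rw [hk j hj hjb]; exact h.price j hj

/-- Summing the slack inequalities over all persons, both sides contain the sum of all prices, which
cancels; an error of `E` per person remains. -/
theorem exists_perm (h : AuctionInv N E B c asg k) (hall : ∀ i < N, asg i ≠ 0) :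
    ∃ π : Equiv.Perm (Fin N), (∀ i : Fin N, asg i = π i + 1) ∧
      ∀ τ : Equiv.Perm (Fin N), ∑ i : Fin N, c i (π i) ≤ ∑ i : Fin N, c i (τ i) + N * E := by
  have hlt : ∀ i : Fin N, asg i - 1 < N := fun i => by
    have := h.le i i.2
    have := hall i i.2
    omega
  have hinj : Function.Injective fun i : Fin N => (⟨asg i - 1, hlt i⟩ : Fin N) := by
    intro i i' he
    have he : asg i - 1 = asg i' - 1 := by simpa using he
    have h1 := hall i i.2
    have h2 := hall i' i'.2
    exact Fin.ext (h.inj i i.2 i' i'.2 h1 (by omega))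
  refine ⟨Equiv.ofBijective _ (Finite.injective_iff_bijective.1 hinj), fun i => ?_, fun τ => ?_⟩
  · have := hall i i.2
    simp only [Equiv.ofBijective_apply]
    omega
  · set π := Equiv.ofBijective _ (Finite.injective_iff_bijective.1 hinj) with hπ
    have hasg : ∀ i : Fin N, asg i = π i + 1 := by
      intro i
      have := hall i i.2
      simp only [hπ, Equiv.ofBijective_apply]
      omega
    have hsum : ∑ i : Fin N, (c i (π i) + k (π i) * E) ≤
        ∑ i : Fin N, (c i (τ i) + k (τ i) * E + E) :=
      Finset.sum_le_sum fun i _ => h.slack i i.2 _ (π i).2 (hasg i) _ (τ i).2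
    rw [Finset.sum_add_distrib, Finset.sum_add_distrib, Finset.sum_add_distrib,
      Equiv.sum_comp π (fun j : Fin N => k j * E), Equiv.sum_comp τ (fun j : Fin N => k j * E)]
      at hsum
    simp only [Finset.sum_const, Finset.card_univ, Fintype.card_fin, smul_eq_mul] at hsum
    omega

/-- The cost bound is a multiple of the increment, so the number of raises per object is at most `2
* (N * N) + 1`, independently of the magnitude of the costs. The sum counts the bids made so far. -/
theorem sum_lt (h : AuctionInv N E (2 * (N * N) * E) c asg k) (hE : 0 < E) (hN : 0 < N) :
    ∑ j ∈ Finset.range N, k j < 4 * (N * N * N) := by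
  have h1 : ∀ j ∈ Finset.range N, k j ≤ 2 * (N * N) + 1 := by
    intro j hj
    have := h.price j (Finset.mem_range.1 hj)
    refine Nat.le_of_mul_le_mul_right ?_ hE
    rw [Nat.succ_mul]
    exact this
  have h2 : ∑ j ∈ Finset.range N, k j ≤ _ := Finset.sum_le_card_nsmul _ _ _ h1
  rw [Finset.card_range, smul_eq_mul] at h2
  have : N * (2 * (N * N) + 1) = 2 * (N * N * N) + N := by ring
  have : 0 < N * N * N := by positivity
  have : N * 1 * 1 ≤ N * N * N := Nat.mul_le_mul (Nat.mul_le_mul le_rfl hN) hN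
  omega

end AuctionInv

/-! ## Permutations of a finite set with a distance function -/

namespace Equiv.Perm

set_option linter.unusedSectionVars false

variable {V : Type*} [Fintype V] [DecidableEq V]

/-- The total length of the arcs `x → π x`. -/
def totalCost (d : V → V → ℕ) (π : Equiv.Perm V) : ℕ := ∑ x, d x (π x)

/-- The arc from `x` to `π (ν x)` is a shortcut of the path through `ν x`. -/
theorem totalCost_mul_le {d : V → V → ℕ} (htri : ∀ x y z, d x z ≤ d x y + d y z)
    (π ν : Equiv.Perm V) : (π * ν).totalCost d ≤ π.totalCost d + ν.totalCost d := by
  have h1 : π.totalCost d = ∑ x, d (ν x) (π (ν x)) :=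
    (Equiv.sum_comp ν fun y => d y (π y)).symm
  rw [h1, totalCost, totalCost, ← Finset.sum_add_distrib]
  refine Finset.sum_le_sum fun x _ => ?_
  rw [mul_apply, add_comm]
  exact htri _ _ _

theorem totalCost_swap_le {d : V → V → ℕ} (hd : ∀ x, d x x = 0) (a b : V) :
    (Equiv.swap a b).totalCost d ≤ d a b + d b a := by
  by_cases hab : a = b
  · subst hab; simp [totalCost, hd]
  · rw [totalCost, ← Finset.sum_subset (Finset.subset_univ {a, b})]
    · rw [Finset.sum_pair hab]; simp
    · intro x _ hx
      simp only [Finset.mem_insert, Finset.mem_singleton, not_or] at hx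
      rw [Equiv.swap_apply_of_ne_of_ne hx.1 hx.2, hd]

/-- A tour can be shortened so that it avoids a set of nodes. -/
theorem exists_bypass {d : V → V → ℕ} (hd : ∀ x, d x x = 0)
    (htri : ∀ x y z, d x z ≤ d x y + d y z) (ρ : Equiv.Perm V) (pos : V → ℕ) (root : V)
    (hρ : ∀ x ≠ root, pos x < pos (ρ x) ∨ ρ x = root) (R : Finset V) :
    root ∉ R → ∃ ρ' : Equiv.Perm V, (∀ x ∈ R, ρ' x = x) ∧
      (∀ x ∉ R, x ≠ root → pos x < pos (ρ' x) ∨ ρ' x = root) ∧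
      ρ'.totalCost d ≤ ρ.totalCost d := by
  induction R using Finset.induction_on with
  | empty => exact fun _ => ⟨ρ, by simp, fun x _ => hρ x, le_rfl⟩
  | insert a R ha ih =>
    intro hroot
    simp only [Finset.mem_insert, not_or] at hroot
    obtain ⟨f, hf, hpos, hcost⟩ := ih hroot.2
    have hfa : ∀ x, x ≠ a → f x ≠ f a := fun x hx h => hx (f.injective h)
    -- The swap sends the predecessor of `a` directly to `f a` and makes `a` a fixed point.
    refine ⟨Equiv.swap a (f a) * f, ?_, ?_, ?_⟩
    · intro x hx
      rw [Finset.mem_insert] at hx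
      by_cases hxa : x = a
      · simp [hxa]
      · have hxR := hx.resolve_left hxa
        have := hfa x hxa
        rw [mul_apply]
        rw [hf x hxR] at this ⊢
        exact Equiv.swap_apply_of_ne_of_ne hxa this
    · intro x hx hxr
      simp only [Finset.mem_insert, not_or] at hx
      rw [mul_apply]
      by_cases hfx : f x = a
      · rw [hfx, Equiv.swap_apply_left]
        have h1 := hpos x hx.2 hxr
        rw [hfx] at h1
        have h2 := hpos a ha (Ne.symm hroot.1)
        rcases h1 with h1 | h1
        · exact h2.imp_left h1.trans
        · exact absurd h1.symm hroot.1
      · rw [Equiv.swap_apply_of_ne_of_ne hfx (hfa x hx.1)]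
        exact hpos x hx.2 hxr
    · refine le_trans ?_ hcost
      by_cases hfix : f a = a
      · rw [hfix, Equiv.swap_self]; rfl
      obtain ⟨y, hy⟩ := f.surjective a
      have hya : y ≠ a := by rintro rfl; exact hfix hy
      -- Only the terms of `a` and of its predecessor `y` change; they are split off on both sides.
      rw [totalCost, totalCost, ← Finset.add_sum_erase _ _ (Finset.mem_univ a),
        ← Finset.add_sum_erase _ _ (Finset.mem_erase.2 ⟨hya, Finset.mem_univ y⟩),
        ← Finset.add_sum_erase Finset.univ (fun x => d x (f x)) (Finset.mem_univ a),
        ← Finset.add_sum_erase (Finset.univ.erase a) (fun x => d x (f x))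
          (Finset.mem_erase.2 ⟨hya, Finset.mem_univ y⟩)]
      have h1 : ∑ x ∈ (Finset.univ.erase a).erase y, d x ((Equiv.swap a (f a) * f) x) =
          ∑ x ∈ (Finset.univ.erase a).erase y, d x (f x) := by
        refine Finset.sum_congr rfl fun x hx => ?_
        simp only [Finset.mem_erase, Finset.mem_univ, and_true] at hx
        rw [mul_apply, Equiv.swap_apply_of_ne_of_ne _ (hfa x hx.2)]
        rw [← hy]
        exact fun h => hx.1 (f.injective h)
      rw [h1]
      simp only [mul_apply, hy, Equiv.swap_apply_right, Equiv.swap_apply_left, hd]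
      have := htri y a (f a)
      omega

/-- `A` contains exactly one element of every cycle of `ν`. -/
def IsTransversal (ν : Equiv.Perm V) (A : Finset V) : Prop :=
  (∀ x, ∃ a ∈ A, SameCycle ν a x) ∧ ∀ a ∈ A, ∀ b ∈ A, SameCycle ν a b → a = b

theorem SameCycle.induction_nat {f : Equiv.Perm V} {a b : V} (h : SameCycle f a b)
    {P : V → Prop} (h0 : P a) (hs : ∀ x, P x → P (f x)) : P b := by
  obtain ⟨i, -, rfl⟩ := h.exists_pow_eq'
  clear h
  induction i with
  | zero => simpa using h0
  | succ i ih => rw [pow_succ', mul_apply]; exact hs _ ih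

/-- The exponent is reduced modulo the minimal period of `a`. With this bound a cycle can be
explored by a counting loop. -/
theorem SameCycle.exists_pow_eq_lt_card {f : Equiv.Perm V} {a b : V} (h : SameCycle f a b) :
    ∃ i < Fintype.card V, (f ^ i) a = b := by
  obtain ⟨i, -, rfl⟩ := h.exists_pow_eq'
  have hper : a ∈ Function.periodicPts f :=
    ⟨orderOf f, orderOf_pos f, by
      rw [Function.IsPeriodicPt, Function.IsFixedPt, iterate_eq_pow, pow_orderOf_eq_one]; rfl⟩
  refine ⟨i % Function.minimalPeriod f a,
    (Nat.mod_lt _ (Function.minimalPeriod_pos_of_mem_periodicPts hper)).trans_le ?_, ?_⟩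
  · exact Function.minimalPeriod_le_card
  · rw [← iterate_eq_pow, Function.iterate_mod_minimalPeriod_eq, iterate_eq_pow]

/-- If `π` permutes representatives of the cycles of `ν`, then `π * ν` joins these cycles along
the cycles of `π`. -/
theorem IsTransversal.mul {ν π : Equiv.Perm V} {A A' : Finset V} (h : ν.IsTransversal A)
    (hπ : ∀ x ∉ A, π x = x) (hsub : A' ⊆ A) (hex : ∀ a ∈ A, ∃ a' ∈ A', SameCycle π a' a)
    (huniq : ∀ a ∈ A', ∀ b ∈ A', SameCycle π a b → a = b) : (π * ν).IsTransversal A' := by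
  have hmem : ∀ x ∈ A, π x ∈ A := by
    intro x hx
    by_contra hn
    have h1 : π x = x := π.injective (hπ _ hn)
    rw [h1] at hn
    exact hn hx
  have key : ∀ a ∈ A, ∀ x, SameCycle ν a x → SameCycle (π * ν) a x := by
    intro a ha x hx
    refine (hx.induction_nat (P := fun x => SameCycle ν a x ∧ SameCycle (π * ν) a x)
      ⟨SameCycle.refl _ _, SameCycle.refl _ _⟩ ?_).2
    rintro y ⟨h1, h2⟩
    have h3 : SameCycle ν a (ν y) := sameCycle_apply_right.2 h1
    refine ⟨h3, ?_⟩
    by_cases hy : ν y ∈ A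
    · rw [← h.2 a ha _ hy h3]
    · have h4 : (π * ν) y = ν y := by rw [mul_apply, hπ _ hy]
      rw [← h4]
      exact sameCycle_apply_right.2 h2
  -- The predecessor of `a` under `ν` is sent to `π a`: here the new cycle passes from the cycle of
  -- `a` to that of `π a`.
  have key' : ∀ a ∈ A, SameCycle (π * ν) a (π a) := by
    intro a ha
    obtain ⟨y, hy⟩ := ν.surjective a
    have h1 : SameCycle ν a y := by
      rw [← sameCycle_apply_right, hy]
    have h2 : (π * ν) y = π a := by rw [mul_apply, hy]
    rw [← h2]
    exact sameCycle_apply_right.2 (key a ha y h1)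
  refine ⟨fun x => ?_, fun a ha b hb hab => ?_⟩
  · obtain ⟨a, ha, hax⟩ := h.1 x
    obtain ⟨a', ha', haa⟩ := hex a ha
    refine ⟨a', ha', SameCycle.trans ?_ (key a ha x hax)⟩
    refine (haa.induction_nat (P := fun x => x ∈ A ∧ SameCycle (π * ν) a' x)
      ⟨hsub ha', SameCycle.refl _ _⟩ ?_).2
    rintro y ⟨h1, h2⟩
    exact ⟨hmem y h1, h2.trans (key' y h1)⟩
  -- Along the new cycle, the representative `c` of the current cycle of `ν` never leaves the cycle
  -- of `a` under `π`.
  · obtain ⟨c, hc, hcb, hac⟩ := hab.induction_nat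
      (P := fun x => ∃ c ∈ A, SameCycle ν c x ∧ SameCycle π a c)
      ⟨a, hsub ha, SameCycle.refl _ _, SameCycle.refl _ _⟩ (by
        rintro y ⟨c, hc, hcy, hac⟩
        have h3 : SameCycle ν c (ν y) := sameCycle_apply_right.2 hcy
        rw [mul_apply]
        by_cases hy : ν y ∈ A
        · have h4 := h.2 c hc _ hy h3
          rw [← h4]
          exact ⟨π c, hmem c hc, SameCycle.refl _ _, sameCycle_apply_right.2 hac⟩
        · rw [hπ _ hy]
          exact ⟨c, hc, h3, hac⟩)
    have := h.2 c hc b (hsub hb) hcb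
    subst this
    exact huniq a ha c hb hac

theorem isTransversal_one : (1 : Equiv.Perm V).IsTransversal Finset.univ :=
  ⟨fun x => ⟨x, Finset.mem_univ x, SameCycle.refl _ _⟩, fun a _ b _ h => by simpa using h⟩

/-- Selection of the element with the least key from every cycle. -/
theorem exists_rep_of_key (π : Equiv.Perm V) {A A' : Finset V} {key : V → ℕ}
    (hπ : ∀ x ∉ A, π x = x)
    (hA' : ∀ a, a ∈ A' ↔ a ∈ A ∧ ∀ i ≤ Fintype.card V, key a ≤ key ((π ^ i) a)) :
    (∀ a ∈ A', ∀ b, SameCycle π a b → key a ≤ key b) ∧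
      ∀ a ∈ A, ∃ a' ∈ A', SameCycle π a' a := by
  have hmem : ∀ x ∈ A, π x ∈ A := by
    intro x hx
    by_contra hn
    have h1 : π x = x := π.injective (hπ _ hn)
    rw [h1] at hn
    exact hn hx
  constructor
  · intro a ha b hab
    obtain ⟨i, hi, rfl⟩ := hab.exists_pow_eq_lt_card
    exact ((hA' a).1 ha).2 i hi.le
  · intro a ha
    obtain ⟨b, hb, hmin⟩ := Finset.exists_min_image (Finset.univ.filter fun b => SameCycle π a b)
      key ⟨a, by simp [SameCycle.refl]⟩
    simp only [Finset.mem_filter, Finset.mem_univ, true_and] at hb hmin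
    refine ⟨b, (hA' b).2 ⟨?_, fun i _ => hmin _ ?_⟩, hb.symm⟩
    · exact hb.induction_nat (P := fun x => x ∈ A) ha hmem
    · exact hb.trans ⟨i, by simp⟩

end Equiv.Perm

/-! ## No-wait flowshop as a travelling salesman problem -/

namespace NoWaitFlowshop

variable (I : NoWaitFlowshop)

/-- The processing times, extended by zeros; job `I.n` is a dummy job. -/
def time (j i : ℕ) : ℕ := if h : j < I.n ∧ i < I.m then I.t ⟨j, h.1⟩ ⟨i, h.2⟩ else 0

/-- The total processing time of job `j` on the first `i` machines. -/
def pre (j i : ℕ) : ℕ := ∑ l ∈ Finset.range i, I.time j l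

/-- The least difference of the starting times of job `j` and of a later job `k`. -/
def delay (j k : ℕ) : ℕ := (Finset.range I.m).sup fun i => I.pre j (i + 1) - I.pre k i

/-- The distances of the travelling salesman problem on the jobs and the dummy job. -/
def dist (x y : Fin (I.n + 1)) : ℕ := if x = y then 0 else I.delay x y

variable {I}

theorem time_of_le {j : ℕ} (h : I.n ≤ j) (i : ℕ) : I.time j i = 0 :=
  dif_neg fun h' => by omega

theorem time_fin (j : Fin I.n) (i : Fin I.m) : I.time j i = I.t j i := dif_pos ⟨j.2, i.2⟩

theorem pre_succ (j i : ℕ) : I.pre j (i + 1) = I.pre j i + I.time j i := Finset.sum_range_succ _ _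

theorem pre_mono (j : ℕ) {i i' : ℕ} (h : i ≤ i') : I.pre j i ≤ I.pre j i' :=
  Finset.sum_le_sum_of_subset (by simpa using h)

theorem pre_of_le {j : ℕ} (h : I.n ≤ j) (i : ℕ) : I.pre j i = 0 :=
  Finset.sum_eq_zero fun _ _ => time_of_le h _

theorem le_delay (j k : ℕ) {i : ℕ} (hi : i < I.m) :
    I.pre j (i + 1) ≤ I.pre k i + I.delay j k := by
  have : I.pre j (i + 1) - I.pre k i ≤ I.delay j k :=
    Finset.le_sup (f := fun i => I.pre j (i + 1) - I.pre k i) (Finset.mem_range.2 hi)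
  omega

theorem delay_le {j k b : ℕ} (h : ∀ i < I.m, I.pre j (i + 1) ≤ I.pre k i + b) :
    I.delay j k ≤ b :=
  Finset.sup_le fun i hi => by
    have := h i (Finset.mem_range.1 hi)
    omega

theorem delay_le_pre (j k : ℕ) : I.delay j k ≤ I.pre j I.m :=
  delay_le fun i hi => by
    have := I.pre_mono j (show i + 1 ≤ I.m from hi)
    omega

/-- The dummy job has zero prefixes, so the maximum is attained on the last machine. -/
theorem delay_of_le_right (j : ℕ) {k : ℕ} (h : I.n ≤ k) : I.delay j k = I.pre j I.m := by
  refine (delay_le_pre j k).antisymm ?_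
  have h1 := I.m_pos
  have := I.le_delay j k (show I.m - 1 < I.m by omega)
  rwa [Nat.sub_add_cancel h1, pre_of_le h, zero_add] at this

/-- On each machine the two inequalities can be chained, because the intermediate job occupies the
machine for a nonnegative time. -/
theorem delay_triangle (i j k : ℕ) : I.delay i k ≤ I.delay i j + I.delay j k :=
  delay_le fun q hq => by
    have h1 := I.le_delay i j hq
    have h2 := I.le_delay j k hq
    have h3 := I.pre_mono j (show q ≤ q + 1 by omega)
    omega

theorem dist_self (x : Fin (I.n + 1)) : I.dist x x = 0 := if_pos rfl

theorem dist_of_ne {x y : Fin (I.n + 1)} (h : x ≠ y) : I.dist x y = I.delay x y := if_neg h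

theorem dist_le_delay (x y : Fin (I.n + 1)) : I.dist x y ≤ I.delay x y := by
  rw [dist]; split_ifs <;> omega

theorem dist_le_pre (x y : Fin (I.n + 1)) : I.dist x y ≤ I.pre x I.m :=
  (dist_le_delay x y).trans (delay_le_pre _ _)

theorem dist_last_right (x : Fin (I.n + 1)) : I.dist x (Fin.last _) = I.pre x I.m := by
  by_cases h : x = Fin.last _
  · rw [h, dist_self, pre_of_le (by simp)]
  · rw [dist_of_ne h, delay_of_le_right _ (by simp)]

theorem dist_last_left (x : Fin (I.n + 1)) : I.dist (Fin.last _) x = 0 := by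
  have := I.dist_le_pre (Fin.last _) x
  rw [pre_of_le (by simp)] at this
  omega

theorem dist_triangle (x y z : Fin (I.n + 1)) : I.dist x z ≤ I.dist x y + I.dist y z := by
  by_cases hxz : x = z
  · rw [hxz, dist_self]; omega
  by_cases hxy : x = y
  · subst hxy; omega
  by_cases hyz : y = z
  · subst hyz; omega
  rw [dist_of_ne hxz, dist_of_ne hxy, dist_of_ne hyz]
  exact delay_triangle _ _ _

/-- The case `j = I.n` is included: the address then lies beyond the input, and the default value
`0` is the processing time of the dummy job. -/
theorem encode_getD {j i : ℕ} (hj : j ≤ I.n) (hi : i < I.m) :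
    I.encode.getD (2 + j * I.m + i) 0 = I.time j i := by
  have h1 : 2 + j * I.m + i = (j * I.m + i) + 1 + 1 := by omega
  rw [encode, h1, List.getD_cons_succ, List.getD_cons_succ]
  have hflat : (List.ofFn fun j => List.ofFn (I.t j)).flatten =
      List.ofFn (n := I.n * I.m) fun k => I.time (k / I.m) (k % I.m) := by
    rw [List.ofFn_mul]
    congr 2
    funext j
    congr 1
    funext i
    rw [← time_fin]
    congr 1
    · simp only []
      rw [mul_comm, Nat.mul_add_div I.m_pos, Nat.div_eq_of_lt i.2, add_zero]
    · simp only []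
      rw [mul_comm, Nat.mul_add_mod, Nat.mod_eq_of_lt i.2]
  rw [hflat, List.getD_eq_getElem?_getD, List.getElem?_ofFn]
  rcases hj.lt_or_eq with hj | rfl
  · have hlt : j * I.m + i < I.n * I.m := by
      have := Nat.mul_le_mul_right I.m (show j + 1 ≤ I.n from hj)
      rw [Nat.succ_mul] at this
      omega
    rw [dif_pos hlt]
    simp only [Option.getD_some]
    rw [mul_comm, Nat.mul_add_div I.m_pos, Nat.div_eq_of_lt hi, add_zero, Nat.mul_add_mod,
      Nat.mod_eq_of_lt hi]
  · rw [dif_neg (by omega), time_of_le le_rfl]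
    rfl

/-! ### Lower bounds -/

namespace IsFeasible

variable {τ : Equiv.Perm (Fin I.n)} {S : I.Schedule}

theorem eq_add_pre (h : I.IsFeasible τ S) (j : Fin I.n) (i : Fin I.m) :
    S j i = S j ⟨0, I.m_pos⟩ + (I.pre j i : ℝ≥0) := by
  obtain ⟨i, hi⟩ := i
  induction i with
  | zero => simp [pre]
  | succ i ih =>
    have h1 := time_fin j ⟨i, by omega⟩
    simp only at h1
    rw [h.no_wait j ⟨i, by omega⟩ ⟨i + 1, hi⟩ rfl, ih (by omega), add_assoc, ← Nat.cast_add, ← h1,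
      ← pre_succ]

theorem add_pre_succ_le_makespan (h : I.IsFeasible τ S) (j : Fin I.n) {i : ℕ} (hi : i < I.m) :
    S j ⟨0, I.m_pos⟩ + (I.pre j (i + 1) : ℝ≥0) ≤ I.makespan S := by
  rw [pre_succ, Nat.cast_add, ← add_assoc]
  have h1 := h.eq_add_pre j ⟨i, hi⟩
  have h2 := time_fin j ⟨i, hi⟩
  simp only at h1 h2
  rw [← h1, h2]
  exact (Finset.le_sup (f := fun i => S j i + (I.t j i : ℝ≥0)) (Finset.mem_univ _)).trans
    (Finset.le_sup (f := fun j => Finset.univ.sup fun i => S j i + (I.t j i : ℝ≥0))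
      (Finset.mem_univ _))

theorem pre_le_makespan (h : I.IsFeasible τ S) (x : Fin (I.n + 1)) :
    (I.pre x I.m : ℝ≥0) ≤ I.makespan S := by
  by_cases hx : (x : ℕ) < I.n
  · have h1 := I.m_pos
    have := h.add_pre_succ_le_makespan ⟨x, hx⟩ (show I.m - 1 < I.m by omega)
    rw [Nat.sub_add_cancel h1] at this
    exact le_add_self.trans this
  · rw [pre_of_le (by omega)]; simp

theorem start_add_delay_le (h : I.IsFeasible τ S) {k l : Fin I.n} (hkl : k < l) :
    S (τ k) ⟨0, I.m_pos⟩ + (I.delay (τ k) (τ l) : ℝ≥0) ≤ S (τ l) ⟨0, I.m_pos⟩ := by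
  obtain ⟨i, hi, he⟩ := Finset.exists_mem_eq_sup (Finset.range I.m)
    ⟨0, Finset.mem_range.2 I.m_pos⟩ (fun i => I.pre (τ k) (i + 1) - I.pre (τ l) i)
  have hi' := Finset.mem_range.1 hi
  have he' : I.delay (τ k) (τ l) = I.pre (τ k) (i + 1) - I.pre (τ l) i := he
  have h1 := h.order ⟨i, hi'⟩ k l hkl
  rw [h.eq_add_pre (τ k) ⟨i, hi'⟩, h.eq_add_pre (τ l) ⟨i, hi'⟩, ← time_fin, add_assoc,
    ← Nat.cast_add, ← pre_succ] at h1
  have h0 := h.order ⟨0, I.m_pos⟩ k l hkl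
  rw [he']
  -- If the truncated difference is zero, the order on the first machine suffices; otherwise the
  -- constraint on the maximizing machine `i` gives the bound.
  rcases le_total (I.pre (τ k) (i + 1)) (I.pre (τ l) i) with hle | hle
  · rw [Nat.sub_eq_zero_of_le hle, Nat.cast_zero, add_zero]
    exact le_self_add.trans h0
  · have h2 : ((I.pre (τ k) (i + 1) - I.pre (τ l) i : ℕ) : ℝ≥0) + (I.pre (τ l) i : ℝ≥0) =
        (I.pre (τ k) (i + 1) : ℝ≥0) := by
      rw [← Nat.cast_add, Nat.sub_add_cancel hle]
    have h3 : S (τ k) ⟨0, I.m_pos⟩ + ((I.pre (τ k) (i + 1) - I.pre (τ l) i : ℕ) : ℝ≥0) +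
        (I.pre (τ l) i : ℝ≥0) ≤ S (τ l) ⟨0, I.m_pos⟩ + (I.pre (τ l) i : ℝ≥0) := by
      rw [add_assoc, h2]; exact h1
    exact le_of_add_le_add_right h3

/-- The tour through the dummy job and the jobs in the order of a schedule is not longer than the
makespan. -/
theorem exists_tour (h : I.IsFeasible τ S) (hn : 0 < I.n) :
    ∃ (ρ : Equiv.Perm (Fin (I.n + 1))) (pos : Fin (I.n + 1) → ℕ),
      (∀ x ≠ Fin.last _, pos x < pos (ρ x) ∨ ρ x = Fin.last _) ∧ (∀ x, ρ x ≠ x) ∧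
      (ρ.totalCost I.dist : ℝ) ≤ I.makespan S := by
  set e : Equiv.Perm (Fin (I.n + 1)) :=
    (finSuccEquivLast.trans (Equiv.optionCongr τ)).trans finSuccEquivLast.symm with he
  have hec : ∀ k : Fin I.n, e k.castSucc = (τ k).castSucc := fun k => by simp [he]
  have hel : e (Fin.last _) = Fin.last _ := by simp [he]
  set ρ : Equiv.Perm (Fin (I.n + 1)) := (e.symm.trans (finRotate (I.n + 1))).trans e with hρ
  have hρe : ∀ y, ρ (e y) = e (y + 1) := fun y => by simp [hρ]
  have hsucc : ∀ k : Fin I.n, k.castSucc + 1 = k.succ := fun k => Fin.coeSucc_eq_succ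
  have hlast : Fin.last I.n + 1 = 0 := by simp
  -- A potential on the nodes: the starting time of a job, and the makespan at the dummy.
  set b : Fin (I.n + 1) → ℝ := fun x =>
    if hx : (x : ℕ) < I.n then (S ⟨x, hx⟩ ⟨0, I.m_pos⟩ : ℝ) else I.makespan S with hb
  have hbc : ∀ j : Fin I.n, b j.castSucc = (S j ⟨0, I.m_pos⟩ : ℝ) := fun j => by simp [hb]
  have hbl : b (Fin.last _) = I.makespan S := by simp [hb]
  have hbn : ∀ x, 0 ≤ b x := fun x => by
    simp only [hb]; split_ifs <;> exact NNReal.coe_nonneg _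
  refine ⟨ρ, fun x => e.symm x, ?_, ?_, ?_⟩
  · intro x hx
    obtain ⟨y, rfl⟩ := e.surjective x
    rcases Fin.eq_castSucc_or_eq_last y with ⟨k, rfl⟩ | rfl
    · left
      simp only [hρe, Equiv.symm_apply_apply, hsucc]
      simp
    · exact absurd hel hx
  · intro x
    obtain ⟨y, rfl⟩ := e.surjective x
    rw [hρe]
    refine fun hc => ?_
    have hc := e.injective hc
    rcases Fin.eq_castSucc_or_eq_last y with ⟨k, rfl⟩ | rfl
    · rw [hsucc, Fin.ext_iff] at hc
      simp at hc
    · rw [hlast, Fin.ext_iff] at hc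
      simp only [Fin.val_zero, Fin.val_last] at hc
      omega
  -- An arc leaving a job costs at most the increase of the potential. The arc leaving the dummy is
  -- free, and the extra term makes up for the drop there. In the sum the potentials cancel and the
  -- makespan remains.
  · have key : ∀ x, (I.dist x (ρ x) : ℝ) ≤
        b (ρ x) - b x + if x = Fin.last _ then (I.makespan S : ℝ) else 0 := by
      intro x
      by_cases hx : x = Fin.last _
      · rw [hx, dist_last_left, if_pos rfl, hbl]
        have := hbn (ρ (Fin.last _))
        simpa
      · rw [if_neg hx, add_zero]
        obtain ⟨y, rfl⟩ := e.surjective x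
        rcases Fin.eq_castSucc_or_eq_last y with ⟨k, rfl⟩ | rfl
        · rw [hρe, hsucc]
          rcases Fin.eq_castSucc_or_eq_last k.succ with ⟨l, hl⟩ | hl
          · rw [hl, hec, hec, hbc, hbc]
            have hkl : k < l := by
              have := congrArg Fin.val hl
              simp only [Fin.val_succ, Fin.val_castSucc] at this
              exact Fin.lt_def.2 (by omega)
            have h1 := h.start_add_delay_le hkl
            have h2 := I.dist_le_delay (τ k).castSucc (τ l).castSucc
            have h1 : (S (τ k) ⟨0, I.m_pos⟩ : ℝ) + (I.delay (τ k) (τ l) : ℝ) ≤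
              S (τ l) ⟨0, I.m_pos⟩ := by exact_mod_cast h1
            have h2 : (I.dist (τ k).castSucc (τ l).castSucc : ℝ) ≤ I.delay (τ k) (τ l) := by
              exact_mod_cast h2
            linarith
          · rw [hl, hel, hec, hbc, hbl, dist_last_right]
            have h0 := I.m_pos
            have h1 := h.add_pre_succ_le_makespan (τ k) (show I.m - 1 < I.m by omega)
            rw [Nat.sub_add_cancel h0] at h1
            have h1 : (S (τ k) ⟨0, I.m_pos⟩ : ℝ) + (I.pre (τ k) I.m : ℝ) ≤ I.makespan S := by
              exact_mod_cast h1
            simp only [Fin.val_castSucc]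
            linarith
        · exact absurd hel hx
    rw [Equiv.Perm.totalCost, Nat.cast_sum]
    refine (Finset.sum_le_sum fun x _ => key x).trans ?_
    rw [Finset.sum_add_distrib, Finset.sum_sub_distrib, Equiv.sum_comp ρ b]
    simp

end IsFeasible

/-- The load of a machine is at most the length of a tour. -/
theorem sum_time_le_totalCost {ρ : Equiv.Perm (Fin (I.n + 1))} (hρ : ∀ x, ρ x ≠ x) {i : ℕ}
    (hi : i < I.m) : ∑ x : Fin (I.n + 1), I.time x i ≤ ρ.totalCost I.dist := by
  have h1 : ∑ x : Fin (I.n + 1), I.pre x (i + 1) ≤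
      ∑ x : Fin (I.n + 1), (I.pre (ρ x) i + I.dist x (ρ x)) :=
    Finset.sum_le_sum fun x _ => by
      rw [dist_of_ne (hρ x).symm]
      exact le_delay _ _ hi
  -- After reindexing by `ρ`, the prefixes before machine `i` cancel and only the operations on
  -- machine `i` remain.
  rw [Finset.sum_add_distrib, Equiv.sum_comp ρ fun y => I.pre y i] at h1
  simp only [pre_succ, Finset.sum_add_distrib] at h1
  rw [Equiv.Perm.totalCost]
  omega

theorem sum_pre_le {ρ : Equiv.Perm (Fin (I.n + 1))} (hρ : ∀ x, ρ x ≠ x) :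
    ∑ x : Fin (I.n + 1), I.pre x I.m ≤ I.m * ρ.totalCost I.dist := by
  simp only [pre]
  rw [Finset.sum_comm]
  refine (Finset.sum_le_card_nsmul _ _ _ fun i hi =>
    sum_time_le_totalCost hρ (Finset.mem_range.1 hi)).trans ?_
  simp

/-! ### From tours to schedules -/

/-- A cyclic permutation of the jobs and the dummy job gives a schedule. -/
theorem exists_schedule_of_tour {ν : Equiv.Perm (Fin (I.n + 1))}
    (hν : ∀ x, ν.SameCycle (Fin.last _) x) :
    ∃ σ : Equiv.Perm (Fin I.n), (∀ k : Fin I.n, (σ k : ℕ) = (ν ^ ((k : ℕ) + 1)) (Fin.last _)) ∧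
      ∃ S : I.Schedule, I.IsFeasible σ S ∧ (I.makespan S : ℝ) ≤ ν.totalCost I.dist := by
  set q : Fin (I.n + 1) → Fin (I.n + 1) := fun k => (ν ^ (k : ℕ)) (Fin.last _) with hq
  have hsurj : Function.Surjective q := by
    intro x
    obtain ⟨i, hi, he⟩ := (hν x).exists_pow_eq_lt_card
    rw [Fintype.card_fin] at hi
    exact ⟨⟨i, hi⟩, he⟩
  have hbij : Function.Bijective q := Finite.surjective_iff_bijective.1 hsurj
  have hinj := hbij.1
  have hq0 : q 0 = Fin.last _ := by simp [hq]
  have hqs : ∀ k : Fin I.n, ν (q k.castSucc) = q k.succ := fun k => by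
    simp [hq, pow_succ', Equiv.Perm.mul_apply]
  -- The nodes `q k` are all distinct and exhaust the cycle, so the last one has to return to the
  -- dummy.
  have hqn : ν (q (Fin.last _)) = Fin.last _ := by
    obtain ⟨y, hy⟩ := ν.surjective (Fin.last _)
    obtain ⟨k, rfl⟩ := hsurj y
    rcases Fin.eq_castSucc_or_eq_last k with ⟨l, rfl⟩ | rfl
    · rw [hqs, ← hq0] at hy
      exact absurd (hinj hy) (Fin.succ_ne_zero _)
    · exact hy
  set p : ℕ → ℕ := fun k => (ν ^ (k + 1)) (Fin.last _) with hp
  have hpq : ∀ k : Fin I.n, p k = q k.succ := fun k => by simp [hp, hq]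
  have hpn : p I.n = I.n := by
    have : p I.n = (ν (q (Fin.last _)) : Fin _) := by
      simp [hp, hq, pow_succ', Equiv.Perm.mul_apply]
    rw [this, hqn, Fin.val_last]
  have hplt : ∀ k : Fin I.n, p k < I.n := by
    intro k
    rw [hpq]
    have h1 : q k.succ ≠ Fin.last _ := by
      rw [← hq0]; exact fun h => Fin.succ_ne_zero _ (hinj h)
    have h2 := (q k.succ).2
    have h3 : (q k.succ : ℕ) ≠ I.n := fun h => h1 (Fin.ext h)
    omega
  have hσinj : Function.Injective fun k : Fin I.n => (⟨p k, hplt k⟩ : Fin I.n) := by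
    intro k l hkl
    have hkl : p k = p l := by simpa using hkl
    rw [hpq, hpq] at hkl
    exact Fin.succ_injective _ (hinj (Fin.ext hkl))
  set σ : Equiv.Perm (Fin I.n) := Equiv.ofBijective _ (Finite.injective_iff_bijective.1 hσinj)
    with hσ
  have hσp : ∀ k : Fin I.n, (σ k : ℕ) = p k := fun k => by simp [hσ]
  set start : ℕ → ℕ := fun k => ∑ k' ∈ Finset.range k, I.delay (p k') (p (k' + 1)) with hstart
  have hstep : ∀ k, ∀ i < I.m,
      start k + I.pre (p k) (i + 1) ≤ start (k + 1) + I.pre (p (k + 1)) i := by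
    intro k i hi
    have h1 : start (k + 1) = start k + I.delay (p k) (p (k + 1)) := Finset.sum_range_succ _ _
    have := I.le_delay (p k) (p (k + 1)) hi
    omega
  have hchain : ∀ i < I.m, ∀ k l, k < l →
      start k + I.pre (p k) (i + 1) ≤ start l + I.pre (p l) i := by
    intro i hi k l hkl
    induction l, hkl using Nat.le_induction with
    | base => exact hstep k i hi
    | succ l _ ih =>
      have h1 := hstep l i hi
      have h2 := I.pre_mono (p l) (show i ≤ i + 1 by omega)
      exact ih.trans ((Nat.add_le_add_left h2 _).trans h1)
  -- The arc leaving the dummy is discarded; the delays of the other arcs, including the final arc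
  -- into the dummy, add up to `start I.n`.
  have hcost : start I.n ≤ ν.totalCost I.dist := by
    have h1 : ν.totalCost I.dist = ∑ k, I.dist (q k) (ν (q k)) :=
      (Equiv.sum_comp (Equiv.ofBijective q hbij) fun x => I.dist x (ν x)).symm
    rw [h1, Fin.sum_univ_succ]
    refine le_add_of_nonneg_of_le (Nat.zero_le _) ?_
    rw [hstart]
    simp only
    rw [Finset.sum_range]
    refine Finset.sum_le_sum fun k _ => ?_
    -- A fixed point has to be excluded because `dist` vanishes on the diagonal, where `delay` need
    -- not.
    have hne : q k.succ ≠ ν (q k.succ) := by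
      intro h
      have h2 := (hν (q k.succ)).eq_of_right h.symm
      rw [← hq0] at h2
      exact Fin.succ_ne_zero _ (hinj h2).symm
    rw [dist_of_ne hne, hpq]
    have : p (k + 1) = (ν (q k.succ) : Fin _) := by
      simp [hp, hq, pow_succ', Equiv.Perm.mul_apply]
    rw [this]
  refine ⟨σ, hσp, fun j i => (start (σ.symm j) + I.pre j i : ℕ), ⟨?_, ?_⟩, ?_⟩
  · intro j i i' hi
    rw [hi, pre_succ, time_fin]
    push_cast
    ring
  · intro i k l hkl
    simp only [Equiv.symm_apply_apply]
    have h1 := hchain i i.2 k l hkl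
    rw [pre_succ, ← hσp, ← hσp, time_fin, ← add_assoc] at h1
    exact_mod_cast h1
  · have : I.makespan (fun j i => ((start (σ.symm j) + I.pre j i : ℕ) : ℝ≥0)) ≤
        ((ν.totalCost I.dist : ℕ) : ℝ≥0) := by
      refine Finset.sup_le fun j _ => Finset.sup_le fun i _ => ?_
      obtain ⟨k, rfl⟩ := σ.surjective j
      simp only [Equiv.symm_apply_apply]
      -- The dummy in position `I.n` has zero prefixes, so all operations end by `start I.n`.
      have h1 := hchain i i.2 k I.n k.2
      rw [pre_succ, ← hσp, hpn, pre_of_le le_rfl, time_fin, ← add_assoc] at h1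
      exact_mod_cast h1.trans hcost
    exact_mod_cast this

end NoWaitFlowshop

/-! ## The analysis of the rounds of the algorithm -/

namespace NoWaitFlowshop

variable {I : NoWaitFlowshop}

/-- The consequences of the existence of a schedule of makespan `T` that the analysis needs. -/
structure TourBound (I : NoWaitFlowshop) (T : ℕ) : Prop where
  pre_le : ∀ x : Fin (I.n + 1), I.pre x I.m ≤ T
  sum_pre_le : ∑ x : Fin (I.n + 1), I.pre x I.m ≤ I.m * T
  exists_tour : ∃ (ρ : Equiv.Perm (Fin (I.n + 1))) (pos : Fin (I.n + 1) → ℕ),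
    (∀ x ≠ Fin.last _, pos x < pos (ρ x) ∨ ρ x = Fin.last _) ∧ ρ.totalCost I.dist ≤ T

/-- Starting times are real, but all lower bounds are integers, so the makespan can be replaced by
its integer part. -/
theorem IsFeasible.tourBound {τ : Equiv.Perm (Fin I.n)} {S : I.Schedule} (h : I.IsFeasible τ S)
    (hn : 0 < I.n) : ∃ T : ℕ, I.TourBound T ∧ (T : ℝ) ≤ I.makespan S := by
  obtain ⟨ρ, pos, hpos, hne, hcost⟩ := h.exists_tour hn
  have hfl : ρ.totalCost I.dist ≤ ⌊(I.makespan S : ℝ)⌋₊ := Nat.le_floor hcost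
  refine ⟨⌊(I.makespan S : ℝ)⌋₊, ⟨fun x => Nat.le_floor ?_, ?_, ρ, pos, hpos, hfl⟩,
    Nat.floor_le (NNReal.coe_nonneg _)⟩
  · exact_mod_cast h.pre_le_makespan x
  · exact (I.sum_pre_le hne).trans (Nat.mul_le_mul_left _ hfl)

/-- The active jobs. -/
def activeSet (I : NoWaitFlowshop) (act : ℕ → ℕ) : Finset (Fin (I.n + 1)) :=
  Finset.univ.filter fun x => act x ≠ 0

theorem mem_activeSet {act : ℕ → ℕ} {x : Fin (I.n + 1)} : x ∈ I.activeSet act ↔ act x ≠ 0 := by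
  simp [activeSet]

/-- The costs in the assignment problem whose solutions are the cycle covers of the active jobs;
`2 * (N * N) * E` is the cost of a forbidden arc. -/
def coverCost (I : NoWaitFlowshop) (E : ℕ) (act : ℕ → ℕ) (i j : ℕ) : ℕ :=
  if i = j then if act i = 0 ∨ i = I.n then 0 else 2 * ((I.n + 1) * (I.n + 1)) * E
  else if act i ≠ 0 ∧ act j ≠ 0 then (I.n + 1) * I.delay i j
  else 2 * ((I.n + 1) * (I.n + 1)) * E

/-- In every cycle of a cycle cover, the job with the least key remains active. -/
def key (I : NoWaitFlowshop) (j : ℕ) : ℕ := I.pre j I.m * (I.n + 1) + (I.n - j)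

/-- The second summand of the key is less than `I.n + 1`, so the key orders lexicographically by
length and then by index. Breaking ties is what leaves exactly one node per cycle. -/
theorem key_injective : Function.Injective fun x : Fin (I.n + 1) => I.key x := by
  intro x y hxy
  have hxy : I.pre x I.m * (I.n + 1) + (I.n - x) = I.pre y I.m * (I.n + 1) + (I.n - y) := hxy
  have h := congrArg (· % (I.n + 1)) hxy
  simp only [Nat.mul_add_mod_self_right] at h
  rw [Nat.mod_eq_of_lt (by omega), Nat.mod_eq_of_lt (by omega)] at h
  exact Fin.ext (by omega)

theorem pre_le_of_key_le {j k : ℕ} (h : I.key j ≤ I.key k) : I.pre j I.m ≤ I.pre k I.m := by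
  by_contra! hlt
  have h1 := Nat.mul_le_mul_right (I.n + 1) (show I.pre k I.m + 1 ≤ I.pre j I.m from hlt)
  rw [Nat.succ_mul] at h1
  simp only [key] at h
  omega

theorem key_last : I.key I.n = 0 := by simp [key, pre_of_le]

theorem coverCost_le {E : ℕ} (hE : ∀ x : Fin (I.n + 1), I.pre x I.m < E) (act : ℕ → ℕ) {i j : ℕ}
    (hi : i < I.n + 1) : I.coverCost E act i j ≤ 2 * ((I.n + 1) * (I.n + 1)) * E := by
  rw [coverCost]
  split_ifs
  · omega
  · omega
  · have h1 := (I.delay_le_pre i j).trans (hE ⟨i, hi⟩).le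
    have : 1 ≤ I.n + 1 := by omega
    calc (I.n + 1) * I.delay i j ≤ (I.n + 1) * E := Nat.mul_le_mul_left _ h1
      _ = 1 * ((I.n + 1) * 1) * E := by ring
      _ ≤ 2 * ((I.n + 1) * (I.n + 1)) * E := by gcongr; omega
  · omega

/-- The state of the algorithm after `r` rounds. -/
structure RoundInv (I : NoWaitFlowshop) (T r : ℕ) (ν : Equiv.Perm (Fin (I.n + 1)))
    (act : ℕ → ℕ) : Prop where
  last : act I.n ≠ 0
  transversal : ν.IsTransversal (I.activeSet act)
  cost : ν.totalCost I.dist ≤ r * (3 * T)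
  length : 2 ^ r * ∑ x ∈ I.activeSet act, I.pre x I.m ≤ ∑ x : Fin (I.n + 1), I.pre x I.m

theorem RoundInv.initial (T : ℕ) {act : ℕ → ℕ} (h : ∀ i < I.n + 1, act i ≠ 0) :
    I.RoundInv T 0 1 act := by
  have : I.activeSet act = Finset.univ := by
    ext x; simp [mem_activeSet, h x x.2]
  refine ⟨h _ (by omega), ?_, ?_, ?_⟩
  · rw [this]; exact Equiv.Perm.isTransversal_one
  · simp [Equiv.Perm.totalCost, dist_self]
  · simp [this]

/-- The properties of an almost optimal solution of the assignment problem. -/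
theorem cover_properties {T E : ℕ} (hT : I.TourBound T)
    (hE : ∀ x : Fin (I.n + 1), I.pre x I.m < E) (hE' : ∃ x : Fin (I.n + 1), E ≤ I.pre x I.m + 1)
    {act : ℕ → ℕ} (hlast : act I.n ≠ 0) {π : Equiv.Perm (Fin (I.n + 1))}
    (hπ : ∀ τ : Equiv.Perm (Fin (I.n + 1)), ∑ i : Fin (I.n + 1), I.coverCost E act i (π i) ≤
      ∑ i : Fin (I.n + 1), I.coverCost E act i (τ i) + (I.n + 1) * E) :
    (∀ x : Fin (I.n + 1), act x = 0 → π x = x) ∧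
      (∀ x : Fin (I.n + 1), act x ≠ 0 → x ≠ Fin.last _ → π x ≠ x) ∧
      π.totalCost I.dist ≤ 3 * T := by
  have hN : 0 < I.n + 1 := by omega
  obtain ⟨ρ, pos, hpos, hcost⟩ := hT.exists_tour
  -- Shortcutting the tour past the inactive nodes gives a competitor without forbidden arcs. The
  -- increasing positions ensure that no active node other than the dummy becomes a fixed point.
  obtain ⟨τ, hfix, hτ, hτc⟩ := Equiv.Perm.exists_bypass I.dist_self I.dist_triangle ρ pos
    (Fin.last _) hpos (I.activeSet act)ᶜ (by simpa [mem_activeSet] using hlast)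
  have hfix : ∀ x : Fin (I.n + 1), act x = 0 → τ x = x := fun x hx =>
    hfix x (by simpa [mem_activeSet] using hx)
  have hτ : ∀ x : Fin (I.n + 1), act x ≠ 0 → x ≠ Fin.last _ → τ x ≠ x := by
    intro x hx hxl he
    rcases hτ x (by simpa [mem_activeSet] using hx) hxl with h | h
    · rw [he] at h; exact lt_irrefl _ h
    · exact hxl (he.symm.trans h)
  have hτa : ∀ x : Fin (I.n + 1), act x ≠ 0 → act (τ x) ≠ 0 := fun x hx h0 =>
    hx (by rwa [τ.injective (hfix _ h0)] at h0)
  have hcτ : ∀ x : Fin (I.n + 1), I.coverCost E act x (τ x) = (I.n + 1) * I.dist x (τ x) := by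
    intro x
    rw [coverCost, dist]
    by_cases hx : x = τ x
    · rw [if_pos (congrArg Fin.val hx), if_pos hx, if_pos, mul_zero]
      by_contra! hc
      exact hτ x hc.1 (fun h => hc.2 (by rw [h]; rfl)) hx.symm
    · have hx0 : act x ≠ 0 := fun h => hx (hfix x h).symm
      rw [if_neg (fun h => hx (Fin.ext h)), if_neg hx, if_pos ⟨hx0, hτa x hx0⟩]
  have hsum : ∑ i : Fin (I.n + 1), I.coverCost E act i (τ i) = (I.n + 1) * τ.totalCost I.dist := by
    rw [Equiv.Perm.totalCost, Finset.mul_sum]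
    exact Finset.sum_congr rfl fun x _ => hcτ x
  have hmain := hπ τ
  rw [hsum] at hmain
  have hE0 : 0 < E := (Nat.zero_le _).trans_lt (hE (Fin.last _))
  have hτE : τ.totalCost I.dist + (I.n + 1) ≤ (I.n + 1) * E := by
    have : ∑ x : Fin (I.n + 1), (I.dist x (τ x) + 1) ≤ ∑ x : Fin (I.n + 1), E :=
      Finset.sum_le_sum fun x _ => (I.dist_le_pre x _).trans_lt (hE x)
    rw [Finset.sum_add_distrib] at this
    simpa [Equiv.Perm.totalCost] using this
  -- Even with the error of the auction, the total cost stays below that of a single forbidden arc.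
  -- The strictness comes from the summand `I.n + 1` gained in `hτE`.
  have hlt : ∀ x : Fin (I.n + 1), I.coverCost E act x (π x) < 2 * ((I.n + 1) * (I.n + 1)) * E := by
    intro x
    have h1 : I.coverCost E act x (π x) ≤ ∑ i : Fin (I.n + 1), I.coverCost E act i (π i) :=
      Finset.single_le_sum (f := fun i : Fin (I.n + 1) => I.coverCost E act i (π i))
        (fun _ _ => Nat.zero_le _) (Finset.mem_univ x)
    have h2 : (I.n + 1) * (τ.totalCost I.dist + (I.n + 1)) ≤ (I.n + 1) * ((I.n + 1) * E) := Nat.mul_le_mul_left _ hτE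
    have h3 : (I.n + 1) * E ≤ (I.n + 1) * ((I.n + 1) * E) := Nat.le_mul_of_pos_left _ hN
    have h4 : 2 * ((I.n + 1) * (I.n + 1)) * E = (I.n + 1) * ((I.n + 1) * E) + (I.n + 1) * ((I.n + 1) * E) := by ring
    have h5 : 0 < (I.n + 1) * (I.n + 1) := Nat.mul_pos hN hN
    rw [mul_add] at h2
    omega
  have hπfix : ∀ x : Fin (I.n + 1), act x = 0 → π x = x := by
    intro x hx
    by_contra hne
    have := hlt x
    rw [coverCost, if_neg (fun h => hne (Fin.ext h).symm), if_neg (by simp [hx])] at this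
    exact lt_irrefl _ this
  refine ⟨hπfix, ?_, ?_⟩
  · intro x hx hxl he
    have := hlt x
    rw [he, coverCost, if_pos rfl, if_neg] at this
    · exact lt_irrefl _ this
    · rintro (h | h)
      · exact hx h
      · exact hxl (Fin.ext h)
  · have hπc : ∑ i : Fin (I.n + 1), I.coverCost E act i (π i) = (I.n + 1) * π.totalCost I.dist := by
      rw [Equiv.Perm.totalCost, Finset.mul_sum]
      refine Finset.sum_congr rfl fun x _ => ?_
      have h1 := hlt x
      rw [coverCost] at h1 ⊢
      rw [dist]
      by_cases hx : x = π x
      · have hx' : (x : ℕ) = π x := congrArg Fin.val hx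
        rw [if_pos hx'] at h1 ⊢
        rw [if_pos hx, mul_zero]
        split_ifs at h1 ⊢ with h2
        · rfl
        · exact absurd h1 (lt_irrefl _)
      · have hx' : ¬ (x : ℕ) = π x := fun h => hx (Fin.ext h)
        rw [if_neg hx'] at h1 ⊢
        rw [if_neg hx]
        split_ifs at h1 ⊢ with h2
        · rfl
        · exact absurd h1 (lt_irrefl _)
    rw [hπc, ← mul_add] at hmain
    -- Dividing by the scaling factor leaves the error `E ≤ T + 1`, hence cost at most `2 * T + 1`.
    -- This is at most `3 * T` unless `T = 0`, in which case all distances out of any node vanish.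
    have h1 := Nat.le_of_mul_le_mul_left hmain hN
    obtain ⟨y, hy⟩ := hE'
    have h2 := hT.pre_le y
    rcases Nat.eq_zero_or_pos T with h0 | h0
    · have : π.totalCost I.dist = 0 :=
        Finset.sum_eq_zero fun x _ => Nat.le_zero.1 (by
          rw [← h0]; exact (I.dist_le_pre x _).trans (hT.pre_le x))
      omega
    · omega

theorem RoundInv.step {T r E : ℕ} (hT : I.TourBound T) {ν : Equiv.Perm (Fin (I.n + 1))}
    {act : ℕ → ℕ} (h : I.RoundInv T r ν act) (hE : ∀ x : Fin (I.n + 1), I.pre x I.m < E)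
    (hE' : ∃ x : Fin (I.n + 1), E ≤ I.pre x I.m + 1) {π : Equiv.Perm (Fin (I.n + 1))}
    (hπ : ∀ τ : Equiv.Perm (Fin (I.n + 1)), ∑ i : Fin (I.n + 1), I.coverCost E act i (π i) ≤
      ∑ i : Fin (I.n + 1), I.coverCost E act i (τ i) + (I.n + 1) * E) {act' : ℕ → ℕ}
    (hact : ∀ x : Fin (I.n + 1), act' x ≠ 0 ↔
      act x ≠ 0 ∧ ∀ i ≤ I.n + 1, I.key x ≤ I.key ((π ^ i) x)) :
    I.RoundInv T (r + 1) (π * ν) act' := by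
  obtain ⟨hfix, hmove, hcost⟩ := cover_properties hT hE hE' h.last hπ
  have hfix' : ∀ x ∉ I.activeSet act, π x = x := fun x hx =>
    hfix x (by simpa [mem_activeSet] using hx)
  have hmem : ∀ a, a ∈ I.activeSet act' ↔ a ∈ I.activeSet act ∧
      ∀ i ≤ Fintype.card (Fin (I.n + 1)), I.key a ≤ I.key ((π ^ i) a) := by
    intro a
    rw [mem_activeSet, mem_activeSet, hact, Fintype.card_fin]
  obtain ⟨hmin, hex⟩ := Equiv.Perm.exists_rep_of_key π (key := fun x => I.key x) hfix' hmem
  have hsub : I.activeSet act' ⊆ I.activeSet act := fun a ha => ((hmem a).1 ha).1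
  have huniq : ∀ a ∈ I.activeSet act', ∀ b ∈ I.activeSet act', π.SameCycle a b → a = b :=
    fun a ha b hb hab => key_injective ((hmin a ha b hab).antisymm (hmin b hb a hab.symm))
  refine ⟨?_, h.transversal.mul hfix' hsub hex huniq, ?_, ?_⟩
  · have := (hact (Fin.last _)).2 ⟨h.last, fun i _ => by
      rw [Fin.val_last, key_last]; exact Nat.zero_le _⟩
    simpa using this
  · have h1 := Equiv.Perm.totalCost_mul_le I.dist_triangle π ν
    have h2 := h.cost
    rw [Nat.succ_mul]
    omega
  -- Each surviving job other than the dummy is matched injectively, by `π`, with its successor,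
  -- which has just been dropped and is at least as long. The dummy contributes nothing to the sum.
  · have hhalf : 2 * ∑ x ∈ I.activeSet act', I.pre x I.m ≤
        ∑ x ∈ I.activeSet act, I.pre x I.m := by
      have h1 : ∑ x ∈ I.activeSet act', I.pre x I.m =
          ∑ x ∈ (I.activeSet act').erase (Fin.last _), I.pre x I.m := by
        symm
        refine Finset.sum_subset (Finset.erase_subset _ _) fun x hx hx' => ?_
        have : x = Fin.last _ := by
          by_contra hne
          exact hx' (Finset.mem_erase.2 ⟨hne, hx⟩)
        rw [this]
        exact pre_of_le (by simp) _
      have h2 : ∑ x ∈ (I.activeSet act').erase (Fin.last _), I.pre x I.m ≤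
          ∑ x ∈ (I.activeSet act').erase (Fin.last _), I.pre (π x) I.m :=
        Finset.sum_le_sum fun x hx => pre_le_of_key_le
          (hmin x (Finset.mem_of_mem_erase hx) _ ⟨1, by simp⟩)
      have h3 : ∑ x ∈ (I.activeSet act').erase (Fin.last _), I.pre (π x) I.m =
          ∑ y ∈ ((I.activeSet act').erase (Fin.last _)).map π.toEmbedding, I.pre y I.m := by
        rw [Finset.sum_map]; rfl
      have h4 : ∑ y ∈ ((I.activeSet act').erase (Fin.last _)).map π.toEmbedding, I.pre y I.m ≤
          ∑ y ∈ I.activeSet act \ I.activeSet act', I.pre y I.m := by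
        refine Finset.sum_le_sum_of_subset fun y hy => ?_
        obtain ⟨x, hx, rfl⟩ := Finset.mem_map.1 hy
        obtain ⟨hxl, hx⟩ := Finset.mem_erase.1 hx
        have hne := hmove x (mem_activeSet.1 (hsub hx)) hxl
        have hsc : π.SameCycle x (π x) := ⟨1, by simp⟩
        refine Finset.mem_sdiff.2 ⟨?_, fun h' => hne (huniq x hx _ h' hsc).symm⟩
        by_contra hn
        exact hne (π.injective (hfix' _ hn))
      have h5 := Finset.sum_sdiff (f := fun x : Fin (I.n + 1) => I.pre x I.m) hsub
      omega
    have := h.length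
    calc 2 ^ (r + 1) * ∑ x ∈ I.activeSet act', I.pre x I.m =
        2 ^ r * (2 * ∑ x ∈ I.activeSet act', I.pre x I.m) := by ring
      _ ≤ 2 ^ r * ∑ x ∈ I.activeSet act, I.pre x I.m := Nat.mul_le_mul_left _ hhalf
      _ ≤ _ := this

/-- The state of the algorithm while the remaining cycles are joined. -/
structure FinishInv (I : NoWaitFlowshop) (b k : ℕ) (ν : Equiv.Perm (Fin (I.n + 1)))
    (act : ℕ → ℕ) : Prop where
  last : act I.n ≠ 0
  transversal : ν.IsTransversal (I.activeSet act)
  cost : ν.totalCost I.dist + ∑ x ∈ I.activeSet act, I.pre x I.m ≤ b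
  done : ∀ j < k, act j = 0

/-- All jobs together have length at most `m * T`, so `r` halvings with `m ≤ 2 ^ r` leave active
jobs of total length at most `T`. -/
theorem RoundInv.finishInv {T r : ℕ} (hT : I.TourBound T) {ν : Equiv.Perm (Fin (I.n + 1))}
    {act : ℕ → ℕ} (h : I.RoundInv T r ν act) (hr : I.m ≤ 2 ^ r) :
    I.FinishInv ((3 * r + 1) * T) 0 ν act := by
  refine ⟨h.last, h.transversal, ?_, by simp⟩
  have h1 : I.m * ∑ x ∈ I.activeSet act, I.pre x I.m ≤ I.m * T :=
    (Nat.mul_le_mul_right _ hr).trans (h.length.trans hT.sum_pre_le)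
  have h2 := Nat.le_of_mul_le_mul_left h1 I.m_pos
  have h3 := h.cost
  have h4 : (3 * r + 1) * T = r * (3 * T) + T := by ring
  omega

theorem FinishInv.skip {b k : ℕ} {ν : Equiv.Perm (Fin (I.n + 1))} {act : ℕ → ℕ}
    (h : I.FinishInv b k ν act) (hk : act k = 0) : I.FinishInv b (k + 1) ν act where
  last := h.last
  transversal := h.transversal
  cost := h.cost
  done j hj := by
    rcases Nat.lt_succ_iff_lt_or_eq.1 hj with hj | rfl
    · exact h.done j hj
    · exact hk

/-- Swapping `k` with the dummy costs at most the length of job `k`, and this is exactly what the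
sum over the active jobs loses; the budget `b` is unchanged. -/
theorem FinishInv.swap {b : ℕ} {ν : Equiv.Perm (Fin (I.n + 1))} {act : ℕ → ℕ} {k : Fin I.n}
    (h : I.FinishInv b k ν act) (hk : act k ≠ 0) :
    I.FinishInv b (k + 1) (Equiv.swap k.castSucc (Fin.last _) * ν)
      (Function.update act k 0) := by
  have hne : k.castSucc ≠ Fin.last I.n := Fin.castSucc_ne_last k
  have hset : I.activeSet (Function.update act k 0) = (I.activeSet act).erase k.castSucc := by
    ext x
    rw [Finset.mem_erase, mem_activeSet, mem_activeSet]
    by_cases hx : x = k.castSucc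
    · simp [hx]
    · have : (x : ℕ) ≠ k := fun h' => hx (Fin.ext h')
      simp [hx, this]
  have hkm : k.castSucc ∈ I.activeSet act := mem_activeSet.2 hk
  have hlm : Fin.last I.n ∈ I.activeSet act := mem_activeSet.2 h.last
  refine ⟨?_, ?_, ?_, ?_⟩
  · have : I.n ≠ k := by omega
    simpa [this] using h.last
  · rw [hset]
    refine h.transversal.mul ?_ (Finset.erase_subset _ _) ?_ ?_
    · intro x hx
      refine Equiv.swap_apply_of_ne_of_ne ?_ ?_
      · rintro rfl; exact hx hkm
      · rintro rfl; exact hx hlm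
    · intro a ha
      by_cases hak : a = k.castSucc
      · refine ⟨Fin.last _, Finset.mem_erase.2 ⟨hne.symm, hlm⟩, 1, ?_⟩
        rw [hak]; simp
      · exact ⟨a, Finset.mem_erase.2 ⟨hak, ha⟩, Equiv.Perm.SameCycle.refl _ _⟩
    · intro a ha c hc hac
      have hfix : ∀ a ∈ (I.activeSet act).erase k.castSucc, a ≠ Fin.last I.n →
          Function.IsFixedPt (Equiv.swap k.castSucc (Fin.last _)) a := fun a ha hal =>
        Equiv.swap_apply_of_ne_of_ne (Finset.mem_erase.1 ha).1 hal
      by_cases hal : a = Fin.last _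
      · by_cases hcl : c = Fin.last _
        · rw [hal, hcl]
        · exact hac.eq_of_right (hfix c hc hcl)
      · exact hac.eq_of_left (hfix a ha hal)
  · have h1 := Equiv.Perm.totalCost_mul_le I.dist_triangle
      (Equiv.swap k.castSucc (Fin.last _)) ν
    have h2 := Equiv.Perm.totalCost_swap_le I.dist_self k.castSucc (Fin.last _)
    rw [dist_last_left, dist_last_right] at h2
    have h3 := Finset.add_sum_erase _ (fun x : Fin (I.n + 1) => I.pre x I.m) hkm
    have h4 := h.cost
    rw [hset]
    omega
  · intro j hj
    by_cases hjk : j = k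
    · simp [hjk]
    · simpa [hjk] using h.done j (by omega)

theorem FinishInv.sameCycle {b : ℕ} {ν : Equiv.Perm (Fin (I.n + 1))} {act : ℕ → ℕ}
    (h : I.FinishInv b I.n ν act) (x : Fin (I.n + 1)) : ν.SameCycle (Fin.last _) x := by
  obtain ⟨a, ha, hax⟩ := h.transversal.1 x
  have : a = Fin.last _ := by
    by_contra hne
    rw [mem_activeSet] at ha
    exact ha (h.done a (by
      have := a.2
      have : (a : ℕ) ≠ I.n := fun h' => hne (Fin.ext h')
      omega))
  rwa [← this]

end NoWaitFlowshop

/-! ## The program -/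

namespace RAM

@[simp]
theorem Memory.set_apply (s : Memory) (a i v a' i' : ℕ) :
    s.set a i v a' i' = if a' = a ∧ i' = i then v else s a' i' := by
  by_cases ha : a' = a
  · subst ha
    rw [Memory.set_apply_same, Function.update_apply]
    simp
  · rw [Memory.set_of_ne _ ha]
    simp [ha]

namespace Expr

instance : Add Expr := ⟨Expr.add⟩

instance : Sub Expr := ⟨Expr.sub⟩

instance : Mul Expr := ⟨Expr.mul⟩

@[simp]
theorem eval_add (s : Memory) (e f : Expr) : (e + f).eval s = e.eval s + f.eval s := rfl

@[simp]
theorem eval_sub (s : Memory) (e f : Expr) : (e - f).eval s = e.eval s - f.eval s := rfl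

@[simp]
theorem eval_mul (s : Memory) (e f : Expr) : (e * f).eval s = e.eval s * f.eval s := rfl

@[simp]
theorem eval_const (s : Memory) (c : ℕ) : (const c).eval s = c := rfl

@[simp]
theorem eval_read (s : Memory) (a : ℕ) (i : Expr) : (read a i).eval s = s a (i.eval s) := rfl

/-- The content of cell `0` of an array. -/
def cell (a : ℕ) : Expr := read a (const 0)

@[simp]
theorem eval_cell (s : Memory) (a : ℕ) : (cell a).eval s = s a 0 := rfl

/-- The number of nodes: the jobs and the dummy job. -/
def nodes : Expr := cell 0 + const 1

@[simp]
theorem eval_nodes (s : Memory) : nodes.eval s = s 0 0 + 1 := rfl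

/-- The number of machines. -/
def machines : Expr := read 0 (const 1)

@[simp]
theorem eval_machines (s : Memory) : machines.eval s = s 0 1 := rfl

end Expr

namespace Cmd

@[simp]
theorem run_seq (p q : Cmd) (s : Memory) : (seq p q).run s = q.run (p.run s) := rfl

@[simp]
theorem run_write (a : ℕ) (i e : Expr) (s : Memory) :
    (write a i e).run s = s.set a (i.eval s) (e.eval s) := rfl

theorem run_ite (e : Expr) (p q : Cmd) (s : Memory) :
    (ite e p q).run s = if e.eval s ≠ 0 then p.run s else q.run s := rfl

@[simp]
theorem run_skip (s : Memory) : skip.run s = s := rfl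

/-- Assignment to cell `0` of an array. -/
def assign (a : ℕ) (e : Expr) : Cmd := write a (.const 0) e

@[simp]
theorem run_assign (a : ℕ) (e : Expr) (s : Memory) :
    (assign a e).run s = s.set a 0 (e.eval s) := rfl

theorem set_self (s : Memory) (a i : ℕ) : s.set a i (s a i) = s := by
  simp [Memory.set]

@[simp]
theorem run_ite_assign_skip (e f : Expr) (a : ℕ) (s : Memory) :
    (ite e (assign a f) skip).run s = s.set a 0 (if e.eval s ≠ 0 then f.eval s else s a 0) := by
  rw [run_ite]
  split_ifs
  · rfl
  · rw [set_self]; rfl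

@[simp]
theorem run_ite_skip_assign (e f : Expr) (a : ℕ) (s : Memory) :
    (ite e skip (assign a f)).run s = s.set a 0 (if e.eval s ≠ 0 then s a 0 else f.eval s) := by
  rw [run_ite]
  split_ifs
  · rw [set_self]; rfl
  · rfl

/-- The array `a` is recomputed cell by cell. -/
def mapArray (x a : ℕ) (e : Expr) (p : Cmd) (v : Expr) : Cmd :=
  .forLoop x e (.seq p <| .write a (.cell x) v)

/-- The new value may depend on the old content of the same cell and on arrays that are not written.
This permits updating an array in place without a copy. -/
theorem run_mapArray {x a : ℕ} {e : Expr} {p : Cmd} {v : Expr} {s : Memory} (n : ℕ)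
    (hn : e.eval s = n) (hxa : x ≠ a) (hxp : x ∉ p.writes) (hap : a ∉ p.writes) (F : ℕ → ℕ)
    (h : ∀ s' i, i < n → s' x 0 = i →
      (∀ b, b ≠ x → b ≠ a → b ∉ p.writes → s' b = s b) → s' a i = s a i →
      v.eval (p.run s') = F i) :
    ∀ i < n, (mapArray x a e p v).run s a i = F i := by
  refine (run_forLoop_induction (I := fun k s' => (∀ i < k, s' a i = F i) ∧
    ∀ i, k ≤ i → s' a i = s a i) n hn ?_ ⟨by simp, by simp⟩ ?_).1
  · intro k s' w hI
    simpa only [Memory.set_of_ne _ hxa.symm] using hI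
  · rintro k hk s' hx hfr ⟨h1, h2⟩
    have hv := h s' k hk hx (fun b hbx hba hbp => hfr b (by
      simp [writes, hbx, hba, hbp])) (h2 k le_rfl)
    simp only [run_seq, run_write, Expr.eval_cell, hv, run_of_notMem_writes p hxp, hx,
      Memory.set_apply, run_of_notMem_writes p hap, true_and]
    constructor
    · intro i hi
      split_ifs with hik
      · rw [hik]
      · exact h1 i (by omega)
    · intro i hi
      rw [if_neg (by omega)]
      exact h2 i (by omega)

theorem mul_add_injective {N i j i' j' : ℕ} (hj : j < N) (hj' : j' < N)
    (h : i * N + j = i' * N + j') : i = i' ∧ j = j' := by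
  have h1 := congrArg (· / N) h
  have h2 := congrArg (· % N) h
  simp only [Nat.mul_add_mod_self_right, Nat.mod_eq_of_lt hj, Nat.mod_eq_of_lt hj'] at h2
  have hN : 0 < N := by omega
  simp only [Nat.mul_comm _ N, Nat.mul_add_div hN, Nat.div_eq_of_lt hj,
    Nat.div_eq_of_lt hj', Nat.add_zero] at h1
  exact ⟨h1, h2⟩

/-- The matrix `a`, indexed by pairs of nodes, is computed entry by entry. -/
def fillMatrix (x y a : ℕ) (p : Cmd) (v : Expr) : Cmd :=
  .forLoop x .nodes (.forLoop y .nodes (.seq p <| .write a (.cell x * .nodes + .cell y) v))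

theorem run_fillMatrix {x y a : ℕ} {p : Cmd} {v : Expr} {s : Memory} (N : ℕ)
    (hN : s 0 0 + 1 = N) (hd : [0, x, y, a].Nodup) (h0p : 0 ∉ p.writes) (hxp : x ∉ p.writes)
    (hyp : y ∉ p.writes) (hap : a ∉ p.writes) (F : ℕ → ℕ → ℕ)
    (h : ∀ s' i j, i < N → j < N → s' x 0 = i → s' y 0 = j →
      (∀ b, b ≠ x → b ≠ y → b ≠ a → b ∉ p.writes → s' b = s b) → v.eval (p.run s') = F i j) :
    ∀ i < N, ∀ j < N, (fillMatrix x y a p v).run s a (i * N + j) = F i j := by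
  simp only [List.nodup_cons, List.mem_cons, List.not_mem_nil, or_false, not_or] at hd
  obtain ⟨⟨h0x, h0y, h0a⟩, ⟨hxy, hxa⟩, hya, -⟩ := hd
  refine run_forLoop_induction (I := fun k s' => ∀ i < k, ∀ j < N, s' a (i * N + j) = F i j)
    N (by rw [Expr.eval_nodes, hN]) ?_ (by simp) ?_
  · intro k s' w hI
    simpa only [Memory.set_of_ne _ (Ne.symm hxa)] using hI
  intro i hi s₁ hx₁ hfr₁ h₁
  have hfr₁' : ∀ b, b ≠ x → b ≠ y → b ≠ a → b ∉ p.writes → s₁ b = s b :=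
    fun b hbx hby hba hbp => hfr₁ b (by simp [writes, hbx, hby, hba, hbp])
  have hN₁ : s₁ 0 0 + 1 = N := by rw [hfr₁' 0 h0x h0y h0a h0p, hN]
  have key := run_forLoop_induction (x := y) (e := .nodes)
    (p := .seq p <| .write a (.cell x * .nodes + .cell y) v) (s := s₁)
    (I := fun k s' => (∀ i' < i, ∀ j < N, s' a (i' * N + j) = F i' j) ∧
      ∀ j < k, s' a (i * N + j) = F i j) N (by rw [Expr.eval_nodes, hN₁])
    (by
      intro k s' w hI
      simpa only [Memory.set_of_ne _ (Ne.symm hya)] using hI) ⟨h₁, by simp⟩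
    (by
      rintro j hj s₂ hy₂ hfr₂ ⟨h₂, h₃⟩
      have hfr₂' : ∀ b, b ≠ y → b ≠ a → b ∉ p.writes → s₂ b = s₁ b :=
        fun b hby hba hbp => hfr₂ b (by simp [writes, hby, hba, hbp])
      have hx₂ : s₂ x 0 = i := by rw [hfr₂' x hxy hxa hxp, hx₁]
      have hN₂ : s₂ 0 0 + 1 = N := by rw [hfr₂' 0 h0y h0a h0p, hN₁]
      have hv := h s₂ i j hi hj hx₂ hy₂ (fun b hbx hby hba hbp => by
        rw [hfr₂' b hby hba hbp, hfr₁' b hbx hby hba hbp])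
      simp only [run_seq, run_write, Expr.eval_add, Expr.eval_mul, Expr.eval_cell,
        Expr.eval_nodes, hv, run_of_notMem_writes p hxp, run_of_notMem_writes p hyp,
        run_of_notMem_writes p h0p, hx₂, hy₂, hN₂, Memory.set_apply,
        run_of_notMem_writes p hap, true_and]
      constructor
      · intro i' hi' j' hj'
        rw [if_neg fun hc => by have := (mul_add_injective hj' hj hc).1; omega]
        exact h₂ i' hi' j' hj'
      · intro j' hj'
        split_ifs with hc
        · rw [(mul_add_injective (by omega) hj hc).2]
        · exact h₃ j' (by
            have : j' ≠ j := by rintro rfl; exact hc rfl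
            omega))
  intro i' hi' j hj
  rcases Nat.lt_succ_iff_lt_or_eq.1 hi' with hlt | rfl
  · exact key.1 i' hlt j hj
  · exact key.2 j hj

end Cmd

end RAM

namespace NoWaitFlowshop

open RAM RAM.Cmd RAM.Expr

/-! The arrays: `0` input, `1` output, `2` delays, `3` the permutation whose cycles are joined,
`4` the active jobs, `5` the assignment, `6` the number of times the price of an object was raised,
`7` the costs of the assignment problem. The other arrays are used for single numbers. -/

/-- The delay of the jobs in cells `10` and `11`. -/
def delayProg : Cmd :=
  .seq (assign 13 (.const 0)) <| .seq (assign 14 (.const 0)) <| .seq (assign 15 (.const 0)) <|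
  .forLoop 12 .machines
    (.seq (assign 13 (cell 13 + read 0 (.const 2 + cell 10 * machines + cell 12))) <|
      .seq (.ite (cell 13 - cell 14 - cell 15) (assign 15 (cell 13 - cell 14)) .skip) <|
      assign 14 (cell 14 + read 0 (.const 2 + cell 11 * machines + cell 12)))

def delaysProg : Cmd := fillMatrix 10 11 2 delayProg (cell 15)

/-- The price increment: more than the length of every job. -/
def incrementProg : Cmd :=
  .seq (assign 16 (.const 1)) <|
  .forLoop 10 .nodes
    (.ite (read 2 (cell 10 * nodes + cell 0) + .const 1 - cell 16)
      (assign 16 (read 2 (cell 10 * nodes + cell 0) + .const 1)) .skip)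

/-- The cost of a forbidden arc. -/
def forbidden : Expr := .const 2 * (nodes * nodes) * cell 16

def coverCostProg : Cmd :=
  fillMatrix 10 11 7
    (.ite (cell 10 - cell 11 + (cell 11 - cell 10))
      (.ite (read 4 (cell 10) * read 4 (cell 11))
        (assign 15 (nodes * read 2 (cell 10 * nodes + cell 11)))
        (assign 15 forbidden))
      (.ite (read 4 (cell 10) * (cell 0 - cell 10))
        (assign 15 forbidden) (assign 15 (.const 0))))
    (cell 15)

/-- The best object for the person in cell `21`. -/
def bestObjectProg : Cmd :=
  .seq (assign 15 (.const 0)) <|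
  .forLoop 22 .nodes
    (.ite (read 7 (cell 21 * nodes + cell 15) + read 6 (cell 15) * cell 16 -
        (read 7 (cell 21 * nodes + cell 22) + read 6 (cell 22) * cell 16))
      (assign 15 (cell 22)) .skip)

/-- The object in cell `15` is taken away from its owner. -/
def releaseProg : Cmd :=
  mapArray 22 5 nodes
    (.seq (assign 14 (read 5 (cell 22))) <|
      .ite (cell 14 - (cell 15 + .const 1) + (cell 15 + .const 1 - cell 14)) .skip
        (assign 14 (.const 0))) (cell 14)

/-- The bid of the person in cell `21`. -/
def bidProg : Cmd :=
  .seq bestObjectProg <| .seq releaseProg <|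
  .seq (.write 5 (cell 21) (cell 15 + .const 1)) <|
  .write 6 (cell 15) (read 6 (cell 15) + .const 1)

/-- A sweep over the persons makes at least one bid as long as somebody is unassigned, so the bound
on the number of bids also bounds the number of sweeps. -/
def auctionProg : Cmd :=
  .seq (mapArray 10 5 nodes .skip (.const 0)) <| .seq (mapArray 10 6 nodes .skip (.const 0)) <|
  .forLoop 20 (.const 4 * (nodes * nodes * nodes))
    (.forLoop 21 .nodes (.ite (read 5 (cell 21)) .skip bidProg))

/-- The length of a job is read off as its delay to the dummy job. -/
def keyExpr (x : ℕ) : Expr := read 2 (cell x * nodes + cell 0) * nodes + (cell 0 - cell x)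

/-- The active jobs are restricted to one job for every cycle of the cycle cover. -/
def selectProg : Cmd :=
  mapArray 10 4 nodes
    (.seq (assign 15 (read 4 (cell 10))) <| .seq (assign 18 (cell 10)) <|
      .forLoop 11 .nodes
        (.seq (assign 18 (read 5 (cell 18) - .const 1)) <|
          .ite (keyExpr 10 - keyExpr 18) (assign 15 (.const 0)) .skip))
    (cell 15)

/-- Assigned objects are stored with an offset of one, hence the subtraction. Cell `17` holds `2 ^
r` after `r` rounds. -/
def roundProg : Cmd :=
  .seq coverCostProg <| .seq auctionProg <|
  .seq (mapArray 10 3 nodes .skip (read 5 (read 3 (cell 10)) - .const 1)) <| .seq selectProg <| assign 17 (cell 17 + cell 17)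

/-- The cycle of the job in cell `19` is joined with the cycle of the dummy job. -/
def joinProg : Cmd :=
  .seq (mapArray 10 3 nodes
    (.seq (assign 14 (read 3 (cell 10))) <|
      .ite (cell 14 - cell 19 + (cell 19 - cell 14))
        (.ite (cell 0 - cell 14) .skip (assign 14 (cell 19)))
        (assign 14 (cell 0)))
    (cell 14)) <|
  .write 4 (cell 19) (.const 0)

/-- The `m` repetitions of the first main loop are a crude bound available before execution; the
test against cell `17` stops the actual rounds as soon as `m ≤ 2 ^ r`. -/
def orderProg : Cmd :=
  .seq delaysProg <| .seq incrementProg <| .seq (mapArray 10 3 nodes .skip (cell 10)) <|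
  .seq (mapArray 10 4 nodes .skip (.const 1)) <| .seq (assign 17 (.const 1)) <|
  .seq (.forLoop 19 machines (.ite (machines - cell 17) roundProg .skip)) <|
  .seq (.forLoop 19 (cell 0) (.ite (read 4 (cell 19)) joinProg .skip)) <|
  .seq (assign 18 (cell 0)) <|
  .forLoop 19 (cell 0) (.seq (assign 18 (read 3 (cell 18))) <| .write 1 (cell 19) (cell 18))

theorem orderProg_wf : orderProg.wf = true := by decide

theorem zero_notMem_writes_orderProg : 0 ∉ orderProg.writes := by decide

variable {I : NoWaitFlowshop}

/-- Array `0` contains the instance. -/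
def IsInput (I : NoWaitFlowshop) (s : Memory) : Prop := s 0 = initMem I.encode 0

theorem IsInput.jobs {s : Memory} (h : I.IsInput s) : s 0 0 = I.n := by
  rw [h]; rfl

theorem IsInput.machines {s : Memory} (h : I.IsInput s) : s 0 1 = I.m := by
  rw [h]; rfl

theorem IsInput.time {s : Memory} (h : I.IsInput s) {j i : ℕ} (hj : j ≤ I.n) (hi : i < I.m) :
    s 0 (2 + j * I.m + i) = I.time j i := by
  rw [h, ← encode_getD hj hi]; rfl

theorem IsInput.congr {s s' : Memory} (h : I.IsInput s) (he : s' 0 = s 0) : I.IsInput s' :=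
  he.trans h

theorem IsInput.run {s : Memory} (h : I.IsInput s) {c : Cmd} (hc : 0 ∉ c.writes) :
    I.IsInput (c.run s) := h.congr (run_of_notMem_writes c hc s)

theorem run_delayProg {s : Memory} (h : I.IsInput s) (hj : s 10 0 ≤ I.n) (hk : s 11 0 ≤ I.n) :
    delayProg.run s 15 0 = I.delay (s 10 0) (s 11 0) := by
  rw [delayProg, run_seq, run_seq, run_seq]
  set s₀ := (assign 15 (.const 0)).run ((assign 14 (.const 0)).run ((assign 13 (.const 0)).run s))
    with hs₀
  have hin₀ : I.IsInput s₀ := h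
  have h10 : s₀ 10 = s 10 := rfl
  have h11 : s₀ 11 = s 11 := rfl
  -- In a round, the prefix of the first job is advanced before the comparison and that of the
  -- second job after it, which matches the indices `i + 1` and `i`.
  refine (run_forLoop_induction (I := fun i s' => s' 13 0 = I.pre (s 10 0) i ∧
    s' 14 0 = I.pre (s 11 0) i ∧ s' 15 0 = (Finset.range i).sup
      fun i => I.pre (s 10 0) (i + 1) - I.pre (s 11 0) i) I.m
    (by rw [eval_machines, hin₀.machines]) ?_ ?_ ?_).2.2
  · intro k s' v hI
    simpa [Memory.set_apply] using hI
  · simp [hs₀, run_assign, Memory.set_apply, eval_const, pre]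
  · rintro i hi s' h12 hfr ⟨h1, h2, h3⟩
    have hin : I.IsInput s' := hin₀.congr (hfr 0 (by decide))
    have e1 : s' 10 0 = s 10 0 := by rw [hfr 10 (by decide), h10]
    have e2 : s' 11 0 = s 11 0 := by rw [hfr 11 (by decide), h11]
    have e3 := hin.time hj hi
    have e4 := hin.time hk hi
    have e5 := hin.machines
    rw [Finset.range_add_one, Finset.sup_insert, pre_succ, pre_succ]
    simp [h1, h2, h3, h12, e1, e2, e3, e4, e5]
    split_ifs <;> omega

end NoWaitFlowshop

/-! ### Correctness of the delays, the costs and the auction -/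

namespace NoWaitFlowshop

open RAM RAM.Cmd RAM.Expr

variable {I : NoWaitFlowshop}

/-- Array `2` contains the delays. -/
def HasDelays (I : NoWaitFlowshop) (s : Memory) : Prop :=
  ∀ i < I.n + 1, ∀ j < I.n + 1, s 2 (i * (I.n + 1) + j) = I.delay i j

theorem HasDelays.congr {s s' : Memory} (h : I.HasDelays s) (he : s' 2 = s 2) :
    I.HasDelays s' := by
  rwa [HasDelays, he]

theorem HasDelays.pre {s : Memory} (h : I.HasDelays s) {i : ℕ} (hi : i < I.n + 1) :
    s 2 (i * (I.n + 1) + I.n) = I.pre i I.m := by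
  rw [h i hi _ (Nat.lt_succ_self _), delay_of_le_right _ le_rfl]

theorem run_delaysProg {s : Memory} (h : I.IsInput s) : I.HasDelays (delaysProg.run s) := by
  refine run_fillMatrix (I.n + 1) (by rw [h.jobs]) (by decide) (by decide) (by decide)
    (by decide) (by decide) _ ?_
  intro s' i j hi hj h10 h11 hfr
  have hin : I.IsInput s' := h.congr (hfr 0 (by decide) (by decide) (by decide) (by decide))
  rw [eval_cell, run_delayProg hin (by omega) (by omega), h10, h11]

theorem run_incrementProg {s : Memory} (h : I.IsInput s) (hd : I.HasDelays s) :
    (∀ x : Fin (I.n + 1), I.pre x I.m < incrementProg.run s 16 0) ∧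
      ∃ x : Fin (I.n + 1), incrementProg.run s 16 0 ≤ I.pre x I.m + 1 := by
  have key := run_forLoop_induction (x := 10) (e := nodes)
    (p := .ite (read 2 (cell 10 * nodes + cell 0) + .const 1 - cell 16)
      (assign 16 (read 2 (cell 10 * nodes + cell 0) + .const 1)) .skip)
    (s := (assign 16 (.const 1)).run s)
    (I := fun k s' => (∀ x < k, I.pre x I.m < s' 16 0) ∧
      ∃ x : Fin (I.n + 1), s' 16 0 ≤ I.pre x I.m + 1) (I.n + 1) (by simp [h.jobs]) ?_ ?_ ?_
  · exact ⟨fun x => key.1 x x.2, key.2⟩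
  · intro k s' v hI
    simpa using hI
  · simp
  · rintro k hk s' h10 hfr ⟨h1, y, hy⟩
    have hin : s' 0 = s 0 := hfr 0 (by decide)
    have hd' : I.HasDelays s' := hd.congr (hfr 2 (by decide))
    have e1 := hd'.pre hk
    have e2 : s' 0 0 = I.n := by rw [hin, h.jobs]
    simp only [run_ite_assign_skip, eval_sub, eval_add, eval_read, eval_mul, eval_cell, eval_const,
      eval_nodes, e2, h10, e1, Memory.set_apply, and_self, if_true]
    split_ifs with hc
    · refine ⟨fun x hx => ?_, ⟨k, hk⟩, le_rfl⟩
      rcases Nat.lt_succ_iff_lt_or_eq.1 hx with hx | rfl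
      · have := h1 x hx
        omega
      · omega
    · refine ⟨fun x hx => ?_, y, hy⟩
      rcases Nat.lt_succ_iff_lt_or_eq.1 hx with hx | rfl
      · exact h1 x hx
      · omega

theorem run_coverCostProg {s : Memory} (h : I.IsInput s) (hd : I.HasDelays s) :
    ∀ i < I.n + 1, ∀ j < I.n + 1, coverCostProg.run s 7 (i * (I.n + 1) + j) =
      I.coverCost (s 16 0) (s 4) i j := by
  refine run_fillMatrix (I.n + 1) (by rw [h.jobs]) (by decide) (by decide) (by decide)
    (by decide) (by decide) _ ?_
  intro s' i j hi hj h10 h11 hfr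
  have e0 : s' 0 0 = I.n := by
    rw [hfr 0 (by decide) (by decide) (by decide) (by decide), h.jobs]
  have e2 : s' 2 (i * (I.n + 1) + j) = I.delay i j := by
    rw [hfr 2 (by decide) (by decide) (by decide) (by decide), hd i hi j hj]
  have e4 : s' 4 = s 4 := hfr 4 (by decide) (by decide) (by decide) (by decide)
  have e16 : s' 16 = s 16 := hfr 16 (by decide) (by decide) (by decide) (by decide)
  simp only [run_ite, eval_add, eval_sub, eval_mul, eval_cell, eval_read, h10, h11, e0,
    e4, coverCost]
  by_cases hij : i = j
  · rw [if_neg (by omega), if_pos hij]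
    by_cases hc : s 4 i = 0 ∨ i = I.n
    · rw [if_neg, if_pos hc]
      · simp
      · rcases hc with hc | hc <;> simp [hc]
    · rw [if_pos, if_neg hc]
      · simp [forbidden, e0, e16]
      · push Not at hc
        exact mul_ne_zero hc.1 (by omega)
  · rw [if_pos (by omega), if_neg hij]
    by_cases hc : s 4 i ≠ 0 ∧ s 4 j ≠ 0
    · rw [if_pos (mul_ne_zero hc.1 hc.2), if_pos hc]
      simp [e0, h10, h11, e2]
    · rw [if_neg, if_neg hc]
      · simp [forbidden, e0, e16]
      · rw [not_not, mul_eq_zero]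
        tauto

section Auction

variable {N : ℕ} {c : ℕ → ℕ → ℕ} {s : Memory}

theorem run_bestObjectProg (hN : s 0 0 + 1 = N)
    (hc : ∀ i < N, ∀ j < N, s 7 (i * N + j) = c i j) (hi : s 21 0 < N) :
    bestObjectProg.run s 15 0 < N ∧ ∀ j < N,
      c (s 21 0) (bestObjectProg.run s 15 0) + s 6 (bestObjectProg.run s 15 0) * s 16 0 ≤
        c (s 21 0) j + s 6 j * s 16 0 := by
  refine run_forLoop_induction (I := fun k s' => s' 15 0 < N ∧ ∀ j < k,
      c (s 21 0) (s' 15 0) + s 6 (s' 15 0) * s 16 0 ≤ c (s 21 0) j + s 6 j * s 16 0)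
    N (by simp [hN]) ?_ ?_ ?_
  · intro k s' v hI
    simpa using hI
  · simp; omega
  · rintro k hk s' h22 hfr ⟨h1, h2⟩
    have e0 : s' 0 0 + 1 = N := by rw [hfr 0 (by decide)]; exact hN
    have e6 : s' 6 = s 6 := hfr 6 (by decide)
    have e7 : s' 7 = s 7 := hfr 7 (by decide)
    have e16 : s' 16 0 = s 16 0 := by rw [hfr 16 (by decide)]; rfl
    have e21 : s' 21 0 = s 21 0 := by rw [hfr 21 (by decide)]; rfl
    simp only [run_ite_assign_skip, eval_sub, eval_add, eval_read, eval_mul, eval_cell,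
      eval_nodes, e0, e6, e7, e16, e21, h22, hc _ hi _ hk, hc _ hi _ h1,
      Memory.set_apply, and_self, if_true]
    split_ifs with hlt
    · refine ⟨hk, fun j hj => ?_⟩
      rcases Nat.lt_succ_iff_lt_or_eq.1 hj with hj | rfl
      · have := h2 j hj
        omega
      · exact le_rfl
    · refine ⟨h1, fun j hj => ?_⟩
      rcases Nat.lt_succ_iff_lt_or_eq.1 hj with hj | rfl
      · exact h2 j hj
      · omega

theorem run_releaseProg (hN : s 0 0 + 1 = N) : ∀ i < N,
    releaseProg.run s 5 i = if s 5 i = s 15 0 + 1 then 0 else s 5 i := by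
  refine run_mapArray N (by rw [eval_nodes, hN]) (by decide) (by decide) (by decide) _ ?_
  intro s' i hi h22 hfr hs'
  have e15 : s' 15 = s 15 := hfr 15 (by decide) (by decide) (by decide)
  simp only [run_seq, run_assign, run_ite_skip_assign, eval_sub, eval_add, eval_read, eval_cell,
    eval_const, h22, hs', e15, Memory.set_apply]
  simp only [Nat.reduceEqDiff, false_and, and_self, if_true, if_false]
  split_ifs <;> omega

theorem run_bidProg {B : ℕ} (hN : s 0 0 + 1 = N)
    (hc : ∀ i < N, ∀ j < N, s 7 (i * N + j) = c i j) (hcB : ∀ i < N, ∀ j < N, c i j ≤ B)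
    (hi : s 21 0 < N) (h0 : s 5 (s 21 0) = 0)
    (h : AuctionInv N (s 16 0) B c (s 5) (s 6)) :
    AuctionInv N (s 16 0) B c (bidProg.run s 5) (bidProg.run s 6) ∧
      ∑ j ∈ Finset.range N, bidProg.run s 6 j = ∑ j ∈ Finset.range N, s 6 j + 1 := by
  obtain ⟨hb, hmin⟩ := run_bestObjectProg hN hc hi
  rw [bidProg, run_seq, run_seq]
  set s₁ := bestObjectProg.run s with hs₁
  have f₁ : ∀ a, a ∉ bestObjectProg.writes → s₁ a = s a := fun a ha =>
    run_of_notMem_writes _ ha s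
  have hrel := run_releaseProg (s := s₁) (N := N) (by rw [f₁ 0 (by decide), hN])
  set s₂ := releaseProg.run s₁ with hs₂
  have f₂ : ∀ a, a ∉ releaseProg.writes → s₂ a = s₁ a := fun a ha =>
    run_of_notMem_writes _ ha s₁
  have e15 : s₂ 15 = s₁ 15 := f₂ 15 (by decide)
  have e21 : s₂ 21 = s 21 := by rw [f₂ 21 (by decide), f₁ 21 (by decide)]
  have e6 : s₂ 6 = s 6 := by rw [f₂ 6 (by decide), f₁ 6 (by decide)]
  rw [f₁ 5 (by decide)] at hrel
  simp only [run_seq, run_write, eval_add, eval_read, eval_cell, eval_const]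
  set b := s₁ 15 0 with hb'
  set i := s 21 0 with hi'
  set s₃ := (s₂.set 5 (s₂ 21 0) (s₂ 15 0 + 1)) with hs₃
  have g5 : ∀ i', s₃ 5 i' = if i' = i then b + 1 else s₂ 5 i' := by
    intro i'
    simp [hs₃, e15, e21, hb', hi']
  have g6 : s₃ 6 = s 6 := by rw [hs₃, Memory.set_of_ne _ (by decide), e6]
  have g15 : s₃ 15 0 = b := by rw [hs₃, Memory.set_of_ne _ (by decide), e15]
  rw [g6, g15]
  have g6' : ∀ j, (s₃.set 6 b (s 6 b + 1)) 6 j = if j = b then s 6 b + 1 else s 6 j := by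
    intro j
    simp [g6]
  rw [Memory.set_of_ne _ (by decide)]
  refine ⟨h.bid hcB hi h0 hb hmin (by rw [g5, if_pos rfl]) ?_ (by rw [g6', if_pos rfl]) ?_, ?_⟩
  · intro i' hi' hne
    rw [g5, if_neg hne, hrel i' hi']
  · intro j _ hj
    rw [g6', if_neg hj]
  · rw [← Finset.add_sum_erase _ _ (Finset.mem_range.2 hb),
      ← Finset.add_sum_erase _ (fun j => s 6 j) (Finset.mem_range.2 hb), g6', if_pos rfl]
    have : ∑ j ∈ (Finset.range N).erase b, (s₃.set 6 b (s 6 b + 1)) 6 j =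
        ∑ j ∈ (Finset.range N).erase b, s 6 j :=
      Finset.sum_congr rfl fun j hj => by rw [g6', if_neg (Finset.mem_erase.1 hj).1]
    omega

theorem run_auctionProg {E : ℕ} (hN : s 0 0 + 1 = N) (hE : s 16 0 = E) (hE0 : 0 < E)
    (hc : ∀ i < N, ∀ j < N, s 7 (i * N + j) = c i j)
    (hcB : ∀ i < N, ∀ j < N, c i j ≤ 2 * (N * N) * E) :
    ∃ π : Equiv.Perm (Fin N), (∀ i : Fin N, auctionProg.run s 5 i = π i + 1) ∧
      ∀ τ : Equiv.Perm (Fin N), ∑ i : Fin N, c i (π i) ≤ ∑ i : Fin N, c i (τ i) + N * E := by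
  have hN0 : 0 < N := by omega
  rw [auctionProg, run_seq, run_seq]
  have ha := run_mapArray (s := s) (x := 10) (a := 5) (e := nodes) (p := .skip) (v := .const 0) N
    (by rw [eval_nodes, hN]) (by decide) (by decide) (by decide) (fun _ => 0)
    (fun _ _ _ _ _ _ => rfl)
  set s₁ := (mapArray 10 5 nodes .skip (.const 0)).run s with hs₁
  have f₁ : ∀ a, a ∉ (mapArray 10 5 nodes .skip (.const 0)).writes → s₁ a = s a := fun a ha =>
    run_of_notMem_writes _ ha s
  have hk := run_mapArray (s := s₁) (x := 10) (a := 6) (e := nodes) (p := .skip) (v := .const 0) N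
    (by rw [eval_nodes, f₁ 0 (by decide), hN]) (by decide) (by decide) (by decide) (fun _ => 0)
    (fun _ _ _ _ _ _ => rfl)
  set s₂ := (mapArray 10 6 nodes .skip (.const 0)).run s₁ with hs₂
  have f₂ : ∀ a, a ∉ (mapArray 10 6 nodes .skip (.const 0)).writes → s₂ a = s₁ a := fun a ha =>
    run_of_notMem_writes _ ha s₁
  rw [← f₂ 5 (by decide)] at ha
  have e0 : s₂ 0 0 + 1 = N := by rw [f₂ 0 (by decide), f₁ 0 (by decide), hN]
  have e7 : ∀ i < N, ∀ j < N, s₂ 7 (i * N + j) = c i j := by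
    rw [f₂ 7 (by decide), f₁ 7 (by decide)]; exact hc
  have e16 : s₂ 16 0 = E := by rw [f₂ 16 (by decide), f₁ 16 (by decide), hE]
  -- After `r` sweeps there have been at least `r` bids, or the assignment is complete. At the end
  -- the first alternative contradicts the bound on the number of bids.
  have main := run_forLoop_induction (x := 20) (e := .const 4 * (nodes * nodes * nodes))
    (p := .forLoop 21 .nodes (.ite (read 5 (cell 21)) .skip bidProg)) (s := s₂)
    (I := fun r s' => AuctionInv N E (2 * (N * N) * E) c (s' 5) (s' 6) ∧
      (r ≤ ∑ j ∈ Finset.range N, s' 6 j ∨ ∀ i < N, s' 5 i ≠ 0)) (4 * (N * N * N))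
    (by simp [e0]) ?_ ?_ ?_
  · obtain ⟨hinv, hr | hall⟩ := main
    · have := hinv.sum_lt hE0 hN0
      omega
    · exact hinv.exists_perm hall
  · intro k s' v hI
    simpa only [Memory.set_of_ne _ (show 5 ≠ 20 by decide),
      Memory.set_of_ne _ (show 6 ≠ 20 by decide)] using hI
  · exact ⟨AuctionInv.initial _ _ _ _ ha hk, Or.inl (Nat.zero_le _)⟩
  · rintro r - s' - hfr ⟨hinv, hr⟩
    have e0' : s' 0 0 + 1 = N := by rw [hfr 0 (by decide), e0]
    -- Within a sweep there are three possibilities: the required bid has been made, or all persons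
    -- visited so far are assigned, or the assignment is complete. A bid may displace another
    -- person, but then the first possibility already holds.
    have inner := run_forLoop_induction (x := 21) (e := nodes)
      (p := .ite (read 5 (cell 21)) .skip bidProg) (s := s')
      (I := fun k s' => AuctionInv N E (2 * (N * N) * E) c (s' 5) (s' 6) ∧
        (r + 1 ≤ ∑ j ∈ Finset.range N, s' 6 j ∨
          (r ≤ ∑ j ∈ Finset.range N, s' 6 j ∧ ∀ i < k, s' 5 i ≠ 0) ∨ ∀ i < N, s' 5 i ≠ 0)) N
      (by rw [eval_nodes, e0']) ?_ ⟨hinv, by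
        rcases hr with hr | hr
        · exact Or.inr (Or.inl ⟨hr, by simp⟩)
        · exact Or.inr (Or.inr hr)⟩ ?_
    · obtain ⟨h1, h2 | ⟨-, h2⟩ | h2⟩ := inner
      · exact ⟨h1, Or.inl h2⟩
      · exact ⟨h1, Or.inr h2⟩
      · exact ⟨h1, Or.inr h2⟩
    · intro k s' v hI
      simpa only [Memory.set_of_ne _ (show 5 ≠ 21 by decide),
        Memory.set_of_ne _ (show 6 ≠ 21 by decide)] using hI
    · rintro i hi t h21 hfr' ⟨h1, h2⟩
      rw [run_ite, eval_read, eval_cell, h21]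
      by_cases h5 : t 5 i = 0
      · rw [if_neg (by simpa using h5)]
        have g0 : t 0 0 + 1 = N := by rw [hfr' 0 (by decide), e0']
        have g7 : ∀ i < N, ∀ j < N, t 7 (i * N + j) = c i j := by
          rw [hfr' 7 (by decide), hfr 7 (by decide)]; exact e7
        have g16 : t 16 0 = E := by rw [hfr' 16 (by decide), hfr 16 (by decide), e16]
        have hbid := run_bidProg (s := t) g0 g7 hcB (by rw [h21]; exact hi) (by rw [h21]; exact h5)
          (by rw [g16]; exact h1)
        rw [g16] at hbid
        refine ⟨hbid.1, Or.inl ?_⟩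
        rw [hbid.2]
        rcases h2 with h2 | ⟨h2, -⟩ | h2
        · omega
        · omega
        · exact absurd h5 (h2 i hi)
      · rw [if_pos h5, run_skip]
        refine ⟨h1, ?_⟩
        rcases h2 with h2 | ⟨h2, h3⟩ | h2
        · exact Or.inl h2
        · refine Or.inr (Or.inl ⟨h2, fun i' hi' => ?_⟩)
          rcases Nat.lt_succ_iff_lt_or_eq.1 hi' with hi' | rfl
          · exact h3 i' hi'
          · exact h5
        · exact Or.inr (Or.inr h2)

end Auction

end NoWaitFlowshop

/-! ### Correctness of the rounds, of the joining and of the whole program -/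

namespace NoWaitFlowshop

open RAM RAM.Cmd RAM.Expr

variable {I : NoWaitFlowshop}

theorem eval_keyExpr {s : Memory} (h : I.IsInput s) (hd : I.HasDelays s) {x : ℕ}
    (hx : s x 0 < I.n + 1) : (keyExpr x).eval s = I.key (s x 0) := by
  simp [keyExpr, key, h.jobs, hd.pre hx]

theorem run_selectProg {s : Memory} (h : I.IsInput s) (hd : I.HasDelays s)
    {π : Equiv.Perm (Fin (I.n + 1))} (hπ : ∀ i : Fin (I.n + 1), s 5 i = π i + 1)
    (x : Fin (I.n + 1)) : selectProg.run s 4 x ≠ 0 ↔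
      s 4 x ≠ 0 ∧ ∀ i ≤ I.n + 1, I.key x ≤ I.key ((π ^ i) x) := by
  have key := run_mapArray (s := s) (x := 10) (a := 4) (e := nodes)
    (p := .seq (assign 15 (read 4 (cell 10))) <| .seq (assign 18 (cell 10)) <|
      .forLoop 11 .nodes
        (.seq (assign 18 (read 5 (cell 18) - .const 1)) <|
          .ite (keyExpr 10 - keyExpr 18) (assign 15 (.const 0)) .skip))
    (v := cell 15) (I.n + 1) (by rw [eval_nodes, h.jobs]) (by decide) (by decide) (by decide)
    (fun j => if hj : j < I.n + 1 then
      if ∀ i ≤ I.n + 1, I.key j ≤ I.key ((π ^ i) ⟨j, hj⟩) then s 4 j else 0 else 0) ?_ x x.2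
  · rw [selectProg, key, dif_pos x.2]
    simp only [Fin.eta]
    split_ifs with hc
    · exact ⟨fun h0 => ⟨h0, hc⟩, fun h0 => h0.1⟩
    · simp [hc]
  intro s' j hj h10 hfr h4
  rw [dif_pos hj, run_seq, run_seq, eval_cell]
  have e0 : s' 0 = s 0 := hfr 0 (by decide) (by decide) (by decide)
  set s₁ := (assign 18 (cell 10)).run ((assign 15 (read 4 (cell 10))).run s') with hs₁
  -- Cell `18` walks along the cycle of `j`, and cell `15` is cleared for good once a smaller key is
  -- met.
  refine (run_forLoop_induction (I := fun k t => t 18 0 = (π ^ k) ⟨j, hj⟩ ∧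
    t 15 0 = if ∀ i ≤ k, I.key j ≤ I.key ((π ^ i) ⟨j, hj⟩) then s 4 j else 0) (I.n + 1)
    (by simp [hs₁, e0, h.jobs]) ?_ ?_ ?_).2
  · intro k t v hI
    simpa using hI
  · simp [hs₁, h10, h4]
  · rintro k hk t h11 hfr' ⟨h18, h15⟩
    have g0 : t 0 = s 0 := by rw [hfr' 0 (by decide)]; exact e0
    have g2 : t 2 = s 2 := by
      rw [hfr' 2 (by decide)]; exact hfr 2 (by decide) (by decide) (by decide)
    have g5 : t 5 = s 5 := by
      rw [hfr' 5 (by decide)]; exact hfr 5 (by decide) (by decide) (by decide)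
    have g10 : t 10 0 = j := by rw [hfr' 10 (by decide)]; exact h10
    rw [run_seq, run_assign]
    have hval : (read 5 (cell 18) - .const 1 : Expr).eval t = (π ^ (k + 1)) ⟨j, hj⟩ := by
      simp [g5, h18, hπ, pow_succ']
    rw [hval]
    set t' := t.set 18 0 ((π ^ (k + 1)) ⟨j, hj⟩ : Fin (I.n + 1)) with ht'
    have k0 : I.IsInput t' := h.congr g0
    have k2 : I.HasDelays t' := hd.congr g2
    have k18 : t' 18 0 = (π ^ (k + 1)) ⟨j, hj⟩ := by simp [ht']
    have k10 : t' 10 0 = j := by simp [ht', g10]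
    have k15 : t' 15 0 = t 15 0 := by simp [ht']
    rw [run_ite_assign_skip, eval_sub, eval_keyExpr k0 k2 (by rw [k10]; exact hj),
      eval_keyExpr k0 k2 (by rw [k18]; exact Fin.is_lt _), k10, k18, eval_const, k15, h15]
    refine ⟨by simp [k18], ?_⟩
    simp only [Memory.set_apply, and_self, if_true]
    by_cases hlt : I.key j ≤ I.key ((π ^ (k + 1)) ⟨j, hj⟩ : Fin (I.n + 1))
    · rw [if_neg (by omega)]
      congr 1
      refine propext ⟨fun hall i hi => ?_, fun hall i hi => hall i (by omega)⟩
      rcases Nat.le_succ_iff.1 hi with hi | rfl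
      · exact hall i hi
      · exact hlt
    · rw [if_pos (by omega), if_neg fun hall => hlt (hall _ le_rfl)]

/-- Array `3` contains the permutation `ν`. -/
def HasPerm (I : NoWaitFlowshop) (s : Memory) (ν : Equiv.Perm (Fin (I.n + 1))) : Prop :=
  ∀ x : Fin (I.n + 1), s 3 x = ν x

theorem run_roundProg {s : Memory} (h : I.IsInput s) (hd : I.HasDelays s)
    (hE : ∀ x : Fin (I.n + 1), I.pre x I.m < s 16 0)
    (hE' : ∃ x : Fin (I.n + 1), s 16 0 ≤ I.pre x I.m + 1) {ν : Equiv.Perm (Fin (I.n + 1))}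
    (hν : I.HasPerm s ν) : ∃ ν' : Equiv.Perm (Fin (I.n + 1)), I.HasPerm (roundProg.run s) ν' ∧
      (∀ T r, I.TourBound T → I.RoundInv T r ν (s 4) →
        I.RoundInv T (r + 1) ν' (roundProg.run s 4)) ∧
      roundProg.run s 17 0 = 2 * s 17 0 := by
  rw [roundProg, run_seq, run_seq, run_seq, run_seq, run_assign]
  have hcost := run_coverCostProg h hd
  set s₁ := coverCostProg.run s with hs₁
  have f₁ : ∀ a, a ∉ coverCostProg.writes → s₁ a = s a := fun a ha =>
    run_of_notMem_writes _ ha s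
  obtain ⟨π, hπ, hopt⟩ := run_auctionProg (s := s₁) (N := I.n + 1) (E := s 16 0)
    (c := I.coverCost (s 16 0) (s 4)) (by rw [f₁ 0 (by decide), h.jobs])
    (by rw [f₁ 16 (by decide)]) ((Nat.zero_le _).trans_lt (hE (Fin.last _))) hcost
    (fun i hi j _ => coverCost_le hE _ hi)
  set s₂ := auctionProg.run s₁ with hs₂
  have f₂ : ∀ a, a ∉ auctionProg.writes → s₂ a = s₁ a := fun a ha =>
    run_of_notMem_writes _ ha s₁
  have hperm := run_mapArray (s := s₂) (x := 10) (a := 3) (e := nodes) (p := .skip)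
    (v := read 5 (read 3 (cell 10)) - .const 1) (I.n + 1)
    (by rw [eval_nodes, f₂ 0 (by decide), f₁ 0 (by decide), h.jobs]) (by decide) (by decide)
    (by decide) (fun i => s₂ 5 (s₂ 3 i) - 1) (fun s' i _ h10 hfr h3 => by
      simp [h10, h3, hfr 5 (by decide) (by decide) (by decide)])
  set s₃ := (mapArray 10 3 nodes .skip (read 5 (read 3 (cell 10)) - .const 1)).run s₂ with hs₃
  have f₃ : ∀ a, a ∉ (mapArray 10 3 nodes .skip
      (read 5 (read 3 (cell 10)) - .const 1)).writes → s₃ a = s₂ a := fun a ha =>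
    run_of_notMem_writes _ ha s₂
  have f : ∀ a, a ∉ coverCostProg.writes → a ∉ auctionProg.writes → a ∉ (mapArray 10 3 nodes .skip
      (read 5 (read 3 (cell 10)) - .const 1)).writes → s₃ a = s a := fun a h1 h2 h3 => by
    rw [f₃ a h3, f₂ a h2, f₁ a h1]
  have hin₃ : I.IsInput s₃ := h.congr (f 0 (by decide) (by decide) (by decide))
  have hd₃ : I.HasDelays s₃ := hd.congr (f 2 (by decide) (by decide) (by decide))
  have hsel := run_selectProg hin₃ hd₃ (π := π) (by rw [f₃ 5 (by decide)]; exact hπ)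
  rw [f 4 (by decide) (by decide) (by decide)] at hsel
  set s₄ := selectProg.run s₃ with hs₄
  have f₄ : ∀ a, a ∉ selectProg.writes → s₄ a = s₃ a := fun a ha =>
    run_of_notMem_writes _ ha s₃
  have e17 : s₄ 17 = s 17 := by
    rw [f₄ 17 (by decide), f 17 (by decide) (by decide) (by decide)]
  refine ⟨π * ν, fun x => ?_, fun T r hT hr => ?_, ?_⟩
  · rw [Memory.set_of_ne _ (by decide), f₄ 3 (by decide), hperm x x.2, f₂ 3 (by decide),
      f₁ 3 (by decide), hν x, hπ, Nat.add_sub_cancel, Equiv.Perm.mul_apply]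
  · rw [Memory.set_of_ne _ (by decide)]
    exact hr.step hT hE hE' hopt hsel
  · simp [e17]; omega

theorem run_joinProg {s : Memory} (h : I.IsInput s) {ν : Equiv.Perm (Fin (I.n + 1))}
    (hν : I.HasPerm s ν) {k : Fin I.n} (hk : s 19 0 = k) :
    I.HasPerm (joinProg.run s) (Equiv.swap k.castSucc (Fin.last _) * ν) ∧
      joinProg.run s 4 = Function.update (s 4) k 0 := by
  rw [joinProg, run_seq, run_write]
  have hperm := run_mapArray (s := s) (x := 10) (a := 3) (e := nodes)
    (p := .seq (assign 14 (read 3 (cell 10))) <|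
      .ite (cell 14 - cell 19 + (cell 19 - cell 14))
        (.ite (cell 0 - cell 14) .skip (assign 14 (cell 19)))
        (assign 14 (cell 0)))
    (v := cell 14) (I.n + 1) (by rw [eval_nodes, h.jobs]) (by decide) (by decide) (by decide)
    (fun j => if hj : j < I.n + 1 then
      ((Equiv.swap k.castSucc (Fin.last _) * ν) ⟨j, hj⟩ : Fin (I.n + 1)) else 0)
    (by
      intro s' j hj h10 hfr h3
      have e0 : s' 0 0 = I.n := by rw [hfr 0 (by decide) (by decide) (by decide), h.jobs]
      have e19 : s' 19 0 = k := by rw [hfr 19 (by decide) (by decide) (by decide), hk]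
      have e3 : s' 3 j = ν ⟨j, hj⟩ := by rw [h3, ← hν]
      rw [dif_pos hj, Equiv.Perm.mul_apply, Equiv.swap_apply_def]
      set y := ν ⟨j, hj⟩ with hy
      have hylt := y.2
      by_cases h1 : y = k.castSucc
      · have h1' : (y : ℕ) = k := congrArg Fin.val h1
        rw [if_pos h1]
        simp [run_ite, h10, e3, e19, e0, h1']
      · have h1' : (y : ℕ) ≠ k := fun h' => h1 (Fin.ext h')
        rw [if_neg h1]
        by_cases h2 : y = Fin.last _
        · have h2' : (y : ℕ) = I.n := congrArg Fin.val h2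
          have h3' : I.n - (k : ℕ) ≠ 0 := by omega
          rw [if_pos h2]
          simp [run_ite, h10, e3, e19, e0, h2', h3']
        · have h2' : (y : ℕ) ≠ I.n := fun h' => h2 (Fin.ext h')
          have h4' : I.n - (y : ℕ) ≠ 0 := by omega
          rw [if_neg h2]
          simp only [run_seq, run_assign, run_ite, run_skip, eval_sub, eval_add, eval_cell,
            eval_read, Memory.set_apply, h10, e3]
          simp only [Nat.reduceEqDiff, false_and, and_self, if_true, if_false, e19, e0]
          rw [if_pos (by omega), if_pos (by omega)]
          simp)
  set s₁ := (mapArray 10 3 nodes (.seq (assign 14 (read 3 (cell 10))) <|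
      .ite (cell 14 - cell 19 + (cell 19 - cell 14))
        (.ite (cell 0 - cell 14) .skip (assign 14 (cell 19)))
        (assign 14 (cell 0))) (cell 14)).run s with hs₁
  have e19 : s₁ 19 0 = k := by rw [hs₁, run_of_notMem_writes _ (by decide), hk]
  have e4 : s₁ 4 = s 4 := by rw [hs₁, run_of_notMem_writes _ (by decide)]
  refine ⟨fun x => ?_, ?_⟩
  · rw [Memory.set_of_ne _ (by decide), hperm x x.2, dif_pos x.2]
  · rw [Memory.set_apply_same, eval_cell, eval_const, e19, e4]

/-- A crude value suffices. It is needed because the invariants presuppose some `T`, whereas the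
claim that the final permutation has a single cycle does not mention one. -/
theorem exists_tourBound (I : NoWaitFlowshop) : ∃ T, I.TourBound T := by
  set L := ∑ x : Fin (I.n + 1), I.pre x I.m with hL
  refine ⟨L + (finRotate (I.n + 1)).totalCost I.dist, fun x => ?_, ?_, finRotate _,
    fun x => x, fun x hx => ?_, Nat.le_add_left _ _⟩
  · exact (Finset.single_le_sum (f := fun x : Fin (I.n + 1) => I.pre x I.m)
      (fun _ _ => Nat.zero_le _) (Finset.mem_univ x)).trans (Nat.le_add_right _ _)
  · exact (Nat.le_add_right _ _).trans (Nat.le_mul_of_pos_left _ I.m_pos)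
  · left
    simp only [coe_finRotate_of_ne_last hx]
    omega

/-- The program computes a cyclic permutation of the nodes and writes the jobs in its order. -/
theorem run_orderProg {s : Memory} (h : I.IsInput s) :
    ∃ (ν : Equiv.Perm (Fin (I.n + 1))) (r : ℕ), 2 ^ r < 2 * I.m ∧
      (∀ T, I.TourBound T → ν.totalCost I.dist ≤ (3 * r + 1) * T) ∧
      (∀ x, ν.SameCycle (Fin.last _) x) ∧
      ∀ k < I.n, orderProg.run s 1 k = (ν ^ (k + 1)) (Fin.last _) := by
  rw [orderProg, run_seq, run_seq, run_seq, run_seq, run_seq, run_seq, run_seq, run_seq]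
  have hd₁ := run_delaysProg h
  have hin₁ : I.IsInput (delaysProg.run s) := h.run (by decide)
  generalize delaysProg.run s = s₁ at hd₁ hin₁ ⊢
  have hE := run_incrementProg hin₁ hd₁
  have hin₂ : I.IsInput (incrementProg.run s₁) := hin₁.run (by decide)
  have hd₂ : I.HasDelays (incrementProg.run s₁) :=
    hd₁.congr (run_of_notMem_writes _ (by decide) _)
  generalize incrementProg.run s₁ = s₂ at hE hin₂ hd₂ ⊢
  have hν₃ := run_mapArray (s := s₂) (x := 10) (a := 3) (e := nodes) (p := .skip)
    (v := cell 10) (I.n + 1) (by rw [eval_nodes, hin₂.jobs]) (by decide) (by decide) (by decide)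
    (fun i => i) (fun s' i _ h10 _ _ => h10)
  have f₃ : ∀ a, a ∉ (mapArray 10 3 nodes .skip (cell 10)).writes →
      (mapArray 10 3 nodes .skip (cell 10)).run s₂ a = s₂ a := fun a ha =>
    run_of_notMem_writes _ ha s₂
  generalize (mapArray 10 3 nodes .skip (cell 10)).run s₂ = s₃ at hν₃ f₃ ⊢
  have ha₄ := run_mapArray (s := s₃) (x := 10) (a := 4) (e := nodes) (p := .skip)
    (v := .const 1) (I.n + 1) (by rw [eval_nodes, f₃ 0 (by decide), hin₂.jobs]) (by decide)
    (by decide) (by decide) (fun _ => 1) (fun _ _ _ _ _ _ => rfl)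
  have f₄ : ∀ a, a ∉ (mapArray 10 4 nodes .skip (.const 1)).writes →
      (mapArray 10 4 nodes .skip (.const 1)).run s₃ a = s₃ a := fun a ha =>
    run_of_notMem_writes _ ha s₃
  generalize (mapArray 10 4 nodes .skip (.const 1)).run s₃ = s₄ at ha₄ f₄ ⊢
  rw [run_assign 17, eval_const]
  -- The program does not know `T`, so the invariant speaks about all admissible values at once,
  -- with `ν` and `r` chosen first.
  have main := run_forLoop_induction (x := 19) (e := machines)
    (p := .ite (machines - cell 17) roundProg .skip) (s := s₄.set 17 0 1)
    (I := fun k s' => ∃ (ν : Equiv.Perm (Fin (I.n + 1))) (r : ℕ), I.HasPerm s' ν ∧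
      s' 17 0 = 2 ^ r ∧ 2 ^ r < 2 * I.m ∧ (I.m ≤ 2 ^ r ∨ k ≤ r) ∧
      ∀ T, I.TourBound T → I.RoundInv T r ν (s' 4)) I.m ?_ ?_ ?_ ?_
  · have f₅ : ∀ a, a ∉ (forLoop 19 machines (.ite (machines - cell 17) roundProg .skip)).writes →
        (forLoop 19 machines (.ite (machines - cell 17) roundProg .skip)).run (s₄.set 17 0 1) a =
          s₄.set 17 0 1 a := fun a ha => run_of_notMem_writes _ ha _
    generalize (forLoop 19 machines (.ite (machines - cell 17) roundProg .skip)).run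
      (s₄.set 17 0 1) = s₅ at main f₅ ⊢
    have hin₅ : I.IsInput s₅ := hin₂.congr (by
      rw [f₅ 0 (by decide), Memory.set_of_ne _ (by decide), f₄ 0 (by decide), f₃ 0 (by decide)])
    obtain ⟨ν, r, hν, -, hr, hmr, hround⟩ := main
    -- If the test never failed, all `m` repetitions were actual rounds, and `m < 2 ^ m`.
    have hmr : I.m ≤ 2 ^ r := hmr.elim id fun hle =>
      hle.trans (Nat.lt_two_pow_self).le
    have fin := run_forLoop_induction (x := 19) (e := cell 0)
      (p := .ite (read 4 (cell 19)) joinProg .skip) (s := s₅)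
      (I := fun k s' => ∃ ν : Equiv.Perm (Fin (I.n + 1)), I.HasPerm s' ν ∧
        ∀ T, I.TourBound T → I.FinishInv ((3 * r + 1) * T) k ν (s' 4)) I.n
      (by rw [eval_cell, hin₅.jobs]) ?_ ⟨ν, hν, fun T hT => (hround T hT).finishInv hT hmr⟩ ?_
    · have f₆ : ∀ a, a ∉ (forLoop 19 (cell 0) (.ite (read 4 (cell 19)) joinProg .skip)).writes →
          (forLoop 19 (cell 0) (.ite (read 4 (cell 19)) joinProg .skip)).run s₅ a = s₅ a :=
        fun a ha => run_of_notMem_writes _ ha _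
      generalize (forLoop 19 (cell 0) (.ite (read 4 (cell 19)) joinProg .skip)).run s₅ = s₆
        at fin f₆ ⊢
      have hin₆ : I.IsInput s₆ := hin₅.congr (f₆ 0 (by decide))
      obtain ⟨ν, hν, hfin⟩ := fin
      obtain ⟨T, hT⟩ := I.exists_tourBound
      refine ⟨ν, r, hr, fun T hT => (Nat.le_add_right _ _).trans (hfin T hT).cost,
        (hfin T hT).sameCycle, ?_⟩
      rw [run_assign, eval_cell, hin₆.jobs]
      refine (run_forLoop_induction (x := 19) (e := cell 0)
        (p := .seq (assign 18 (read 3 (cell 18))) <| .write 1 (cell 19) (cell 18))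
        (s := s₆.set 18 0 I.n)
        (I := fun k s' => s' 18 0 = (ν ^ k) (Fin.last _) ∧
          ∀ i < k, s' 1 i = (ν ^ (i + 1)) (Fin.last _)) I.n ?_ ?_ ?_ ?_).2
      · simp [hin₆.jobs]
      · intro k s' v hI
        simpa using hI
      · simp
      · rintro k hk s' h19 hfr ⟨h18, h1⟩
        have e3 : s' 3 = s₆ 3 := hfr 3 (by decide)
        have hval : s' 3 (s' 18 0) = (ν ^ (k + 1)) (Fin.last _) := by
          rw [e3, h18, hν, pow_succ', Equiv.Perm.mul_apply]
        refine ⟨by simp [hval], fun i hi => ?_⟩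
        simp only [run_seq, run_assign, run_write, eval_read, eval_cell, Memory.set_apply, hval]
        simp only [Nat.reduceEqDiff, false_and, and_self, if_true, if_false, h19, true_and]
        split_ifs with hik
        · rw [hik]
        · simpa using h1 i (by omega)
    · intro k s' v hI
      simpa only [HasPerm, Memory.set_of_ne _ (show 3 ≠ 19 by decide),
        Memory.set_of_ne _ (show 4 ≠ 19 by decide)] using hI
    · rintro k hk s' h19 hfr ⟨ν, hν, hfin⟩
      rw [run_ite, eval_read, eval_cell, h19]
      by_cases h4 : s' 4 k = 0
      · rw [if_neg (by simpa using h4), run_skip]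
        exact ⟨ν, hν, fun T hT => (hfin T hT).skip h4⟩
      · rw [if_pos h4]
        have hj := run_joinProg (hin₅.congr (hfr 0 (by decide))) hν (k := ⟨k, hk⟩) h19
        refine ⟨_, hj.1, fun T hT => ?_⟩
        rw [hj.2]
        exact FinishInv.swap (k := ⟨k, hk⟩) (hfin T hT) h4
  · rw [eval_machines, Memory.set_of_ne _ (by decide), f₄ 0 (by decide), f₃ 0 (by decide),
      hin₂.machines]
  · intro k s' v hI
    simpa only [HasPerm, Memory.set_of_ne _ (show 3 ≠ 19 by decide),
      Memory.set_of_ne _ (show 4 ≠ 19 by decide),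
      Memory.set_of_ne _ (show 17 ≠ 19 by decide)] using hI
  · have := I.m_pos
    refine ⟨1, 0, fun x => ?_, by simp, by omega, Or.inr le_rfl,
      fun T _ => RoundInv.initial T ?_⟩
    · rw [Memory.set_of_ne _ (by decide), f₄ 3 (by decide), hν₃ x x.2]; rfl
    · intro i hi
      rw [Memory.set_of_ne _ (by decide), ha₄ i hi]
      exact one_ne_zero
  · rintro k hk s' h19 hfr ⟨ν, r, hν, h17, hr, hmr, hround⟩
    have f : ∀ a, a ∉ (forLoop 19 machines (.ite (machines - cell 17) roundProg .skip)).writes →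
        a ∉ (mapArray 10 4 nodes .skip (.const 1)).writes →
        a ∉ (mapArray 10 3 nodes .skip (cell 10)).writes → a ≠ 17 → s' a = s₂ a :=
      fun a h1 h2 h3 h4 => by rw [hfr a h1, Memory.set_of_ne _ h4, f₄ a h2, f₃ a h3]
    have hin : I.IsInput s' := hin₂.congr (f 0 (by decide) (by decide) (by decide) (by decide))
    rw [run_ite, eval_sub, eval_machines, eval_cell, hin.machines, h17]
    by_cases hlt : I.m ≤ 2 ^ r
    · rw [if_neg (by omega), run_skip]
      exact ⟨ν, r, hν, h17, hr, Or.inl hlt, hround⟩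
    · rw [if_pos (by omega)]
      have e16 : s' 16 = s₂ 16 := f 16 (by decide) (by decide) (by decide) (by decide)
      obtain ⟨ν', hν', hstep, h17'⟩ := run_roundProg hin
        (hd₂.congr (f 2 (by decide) (by decide) (by decide) (by decide)))
        (by rw [e16]; exact hE.1) (by rw [e16]; exact hE.2) hν
      refine ⟨ν', r + 1, hν', by rw [h17', h17, pow_succ]; ring, by rw [pow_succ]; omega, ?_,
        fun T hT => hstep T r hT (hround T hT)⟩
      right
      rcases hmr with hmr | hmr
      · exact absurd hmr hlt
      · omega

/-! ## The theorem -/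

theorem bounded_initMem (w : List ℕ) : (initMem w).Bounded (bitLength w) := by
  intro a i
  rw [initMem]
  split_ifs
  · rw [List.getD_eq_getElem?_getD]
    by_cases hi : i < w.length
    · rw [List.getElem?_eq_getElem hi, Option.getD_some, bitLength]
      have : Nat.size w[i] + 1 ≤ (w.map fun x => Nat.size x + 1).sum :=
        List.single_le_sum (by simp) _ (List.mem_map.2 ⟨w[i], List.getElem_mem hi, rfl⟩)
      omega
    · simp [List.getElem?_eq_none (not_lt.1 hi)]
  · simp

/-- Even a processing time of zero costs one separator. -/
theorem mul_le_bitLength (I : NoWaitFlowshop) : I.n * I.m ≤ bitLength I.encode := by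
  have h1 : ∀ w : List ℕ, w.length ≤ bitLength w := by
    intro w
    induction w with
    | nil => simp
    | cons a w ih =>
      simp only [bitLength, List.map_cons, List.sum_cons, List.length_cons] at ih ⊢
      omega
  refine le_trans ?_ (h1 _)
  simp only [encode, List.length_cons, List.length_flatten, List.map_ofFn, Function.comp_def,
    List.length_ofFn, List.sum_ofFn, Finset.sum_const, Finset.card_univ, Fintype.card_fin,
    smul_eq_mul]
  omega

theorem isApproximate_of_tour {ν : Equiv.Perm (Fin (I.n + 1))} {r : ℕ} (hn : 0 < I.n)
    (hr : 2 ^ r < 2 * I.m)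
    (hcost : ∀ T, I.TourBound T → ν.totalCost I.dist ≤ (3 * r + 1) * T)
    {σ : Equiv.Perm (Fin I.n)} {S : I.Schedule} (hS : I.IsFeasible σ S)
    (hSν : (I.makespan S : ℝ) ≤ ν.totalCost I.dist) :
    I.IsApproximate (max 1 (7 * Real.logb 2 I.m)) σ := by
  refine ⟨S, hS, fun τ S' hS' => ?_⟩
  obtain ⟨T, hT, hTS⟩ := hS'.tourBound hn
  have h1 : (ν.totalCost I.dist : ℝ) ≤ (3 * r + 1) * T := by exact_mod_cast hcost T hT
  -- For `r = 0` the ratio is `1`. Otherwise `m ≥ 2`, and `r ≤ 1 + log₂ m` gives `3 * r + 1 ≤ 4 + 3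
  -- * log₂ m ≤ 7 * log₂ m`.
  have hρ : (3 * r + 1 : ℝ) ≤ max 1 (7 * Real.logb 2 I.m) := by
    have h0 := I.m_pos
    rcases Nat.eq_zero_or_pos r with rfl | hr0
    · simp
    · refine le_max_of_le_right ?_
      have hm : 2 ≤ I.m := by
        have : 2 ^ 1 ≤ 2 ^ r := Nat.pow_le_pow_right two_pos hr0
        omega
      have hlog1 : (1 : ℝ) ≤ Real.logb 2 I.m := by
        rw [Real.le_logb_iff_rpow_le one_lt_two (by exact_mod_cast h0), Real.rpow_one]
        exact_mod_cast hm
      have hlogr : (r : ℝ) ≤ 1 + Real.logb 2 I.m := by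
        have h2 : (r : ℝ) = Real.logb 2 (2 ^ r) := by
          rw [← Real.rpow_natCast, Real.logb_rpow two_pos (by norm_num)]
        have h3 : (1 : ℝ) + Real.logb 2 I.m = Real.logb 2 (2 * I.m) := by
          rw [Real.logb_mul (by norm_num) (by exact_mod_cast h0.ne'),
            Real.logb_self_eq_one one_lt_two]
        rw [h2, h3]
        refine Real.logb_le_logb_of_le one_lt_two (by positivity) ?_
        exact_mod_cast hr.le
      linarith
  calc (I.makespan S : ℝ) ≤ (3 * r + 1) * T := hSν.trans h1
    _ ≤ (3 * r + 1) * I.makespan S' := by gcongr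
    _ ≤ _ := by gcongr

end NoWaitFlowshop

theorem mainTheorem3 :
    ∃ (C : ℝ) (P : RAM.Prog),
      IsNoWaitFlowshopApproximation P (fun m => max 1 (C * Real.logb 2 (m : ℝ))) := by
  obtain ⟨g, time, hrun⟩ := RAM.Cmd.exists_exec_le NoWaitFlowshop.orderProg_wf
    NoWaitFlowshop.zero_notMem_writes_orderProg
  -- Without jobs, `m` is not bounded by the length of the input, in which it is written in binary,
  -- and a loop over the machines could take exponential time; hence the initial test. With a job,
  -- both `n` and `m` are at most the input length, which also bounds the bits of each number, so
  -- the time bound is evaluated at twice this length.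
  refine ⟨7, .ite (.read 0 (.const 0)) NoWaitFlowshop.orderProg.compile .skip,
    time.comp (2 * Polynomial.X) + 2 * Polynomial.X + 5, fun I => ?_⟩
  have hcost : (RAM.Expr.read 0 (.const 0)).cost (RAM.initMem I.encode) +
      (1 + Nat.size ((RAM.Expr.read 0 (.const 0)).eval (RAM.initMem I.encode))) ≤
      2 * RAM.bitLength I.encode + 3 := by
    have := NoWaitFlowshop.bounded_initMem I.encode 0 0
    simp only [RAM.Expr.cost, RAM.Expr.eval, Nat.size_zero]
    omega
  have hn0 : RAM.initMem I.encode 0 0 = I.n := rfl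
  have hn1 : RAM.initMem I.encode 0 1 = I.m := rfl
  rcases Nat.eq_zero_or_pos I.n with hn | hn
  · have hempty : IsEmpty (Fin I.n) := by rw [hn]; infer_instance
    refine ⟨_, _, 1, RAM.Exec.ite_false (hn0.trans hn) (RAM.Exec.skip _), ?_,
      fun k => hempty.elim k, fun j => hempty.elim j, ⟨fun j => hempty.elim j,
        fun _ k => hempty.elim k⟩, fun τ S' _ => ?_⟩
    · simp only [Polynomial.eval_add, Polynomial.eval_mul, Polynomial.eval_X,
        Polynomial.eval_ofNat]
      omega
    · have h0 : ∀ S : I.Schedule, I.makespan S = 0 := fun S => by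
        simp [NoWaitFlowshop.makespan, Finset.univ_eq_empty]
      rw [h0, h0]
      simp
  · have hbit := I.mul_le_bitLength
    have hnb : I.n ≤ RAM.bitLength I.encode := (Nat.le_mul_of_pos_right _ I.m_pos).trans hbit
    have hmb : I.m ≤ RAM.bitLength I.encode := (Nat.le_mul_of_pos_left _ hn).trans hbit
    obtain ⟨⟨t, ht, htime⟩, -⟩ := hrun (RAM.bitLength I.encode) (RAM.bitLength I.encode)
      (RAM.initMem I.encode) hnb hmb (NoWaitFlowshop.bounded_initMem _)
    obtain ⟨ν, r, hr, hcν, hsame, hout⟩ :=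
      NoWaitFlowshop.run_orderProg (I := I) (s := RAM.initMem I.encode) rfl
    obtain ⟨σ, hσ, S, hS, hSν⟩ := NoWaitFlowshop.exists_schedule_of_tour hsame
    refine ⟨_, _, σ, RAM.Exec.ite_true (by rw [RAM.Expr.eval, RAM.Expr.eval, hn0]; omega) ht, ?_,
      fun k => ?_, NoWaitFlowshop.isApproximate_of_tour hn hr hcν hS hSν⟩
    · simp only [Polynomial.eval_add, Polynomial.eval_mul, Polynomial.eval_X,
        Polynomial.eval_ofNat, Polynomial.eval_comp]
      rw [← two_mul] at htime
      omega
    · rw [hout k k.2, hσ]
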